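/- Let $H=(U_H,E_H)$ be an undirected multigraph without self-loops, with finitely many edges, $E_H=E_1\,\dot\cup\cdots\dot\cup\,E_n$ a partition of the edges into $n$ (possibly empty) colour classes, and for each agent $i\in\{1,\dots,n\}$ let $\succ_i$ be a weak ranking (a linear order with ties) of $E_i$. A *colorful forest* is a forest with at most one edge of each colour. Agent $i$ prefers $F$ to $F'$ if $F$ has an edge of colour $i$ and $F'$ has none, or if both have one and $\succ_i$ strictly prefers that of $F$; $\phi(F,F')$ is the number of agents preferring $F$ to $F'$. A colorful forest $F$ is *popular* if $\phi(F,F')\ge\phi(F',F)$ for all colorful forests $F'$, and the *popular colorful forest polytope* is the convex hull in $\mathbb R^{E_H}$ of the incidence vectors of the popular colorful forests. *Padded instance.* $G$ arises from $H$ by adding, for each $i$, an edge $e_i$ of colour $i$ between two new vertices, which is worst for agent $i$. Let $E=E_H\cup\{e_1,\dots,e_n\}$ and $\delta(i)=E_i\cup\{e_i\}$. Call a set of edges of $G$ independent if it is a forest with at most $n$ edges; $\mathrm{rank}(S)$ is the maximum size of an independent subset of $S$, and $\mathrm{span}(S)=\{e\in E:\mathrm{rank}(S+e)=\mathrm{rank}(S)\}$.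 A *colorful base* is a colorful forest of $G$ with $n$ edges. The constraints (LP1) are $$\sum_{e\in\delta(i)}x_e=1\ (1\le i\le n),\qquad \sum_{e\in S}x_e\le\mathrm{rank}(S)\ (S\subseteq E),\qquad x\ge 0 .$$ *The edge set of a multichain.* For $\mathcal C=(C_1\subseteq\dots\subseteq C_p=E)$, let $\mathrm{lev}(e)=\min\{i:e\in C_i\}$ and $\mathrm{lev}^*(i)=\max_{e\in\delta(i)}\mathrm{lev}(e)$. An edge $e\in\delta(i)$ belongs to $E(\mathcal C)$ iff either $\mathrm{lev}(e)=\mathrm{lev}^*(i)$ and no $f\in\delta(i)$ of that level has $f\succ_i e$; or $\mathrm{lev}(e)=\mathrm{lev}^*(i)-1$, no $f\in\delta(i)$ of level $\mathrm{lev}^*(i)-1$ has $f\succ_i e$, and $e\succ_i f$ for all $f\in\delta(i)$ of level $\mathrm{lev}^*(i)$. *Algorithm on $G$.* Start with $p=1$, $C_1=E$. While $p\le n$: choose an independent set $I\subseteq E(\mathcal C)$ with at most one edge of each colour such that $(|I\cap C_1|,\dots,|I\cap C_p|)$ is lexicographically maximum. If $|I\cap C_i|=\mathrm{rank}(C_i)$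 for all $i$, return $I$. Otherwise let $k$ be the least index with $|I\cap C_k|<\mathrm{rank}(C_k)$ and replace $C_k$ by $\mathrm{span}(I\cap C_k)$; if $k=p$, also increase $p$ by one and set $C_p=E$. If the loop ends, nothing is returned. **Theorem.** Suppose that some run of the algorithm returns $F$, and let $\mathcal C$ be the multichain at that moment. Then $\mathcal C$ is a dual certificate of the colorful base $F$, that is, $\emptyset\subsetneq C_1\subsetneq\dots\subsetneq C_p=E$, $F\subseteq E(\mathcal C)$ and $\mathrm{span}(F\cap C_i)=C_i$ for all $i$. Moreover $p\le 2$, i.e. $\mathcal C=\{E\}$ or $\mathcal C=\{C,E\}$, and the polytope $$\Bigl\{x\in\mathbb R^{E}:\ x\text{ satisfies (LP1)},\ \ \sum_{e\in C}x_e=\mathrm{rank}(C),\ \ x_e=0\text{ for all }e\in E\setminus E(\mathcal C)\Bigr\}$$ (without the constraint for $C$ if $\mathcal C=\{E\}$) is an extended formulation of the popular colorful forest polytope of $H$: its image under the coordinate projection $\mathbb R^{E}\to\mathbb R^{E_H}$ that forgets $x_{e_1},\dots,x_{e_n}$ is exactly the popular colorful forest polytope of $H$. -/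

import Mathlib

/-- An undirected multigraph with vertices `U` and edges `E`, whose edges are coloured with `n`
colours (one agent per colour), together with the preferences of the agents:
`pref e f` means `e ≻ f`, and it is only ever consulted for edges `e`, `f` of the same colour. -/
structure ColorfulGraph (U E : Type*) (n : ℕ) where
  ends : E → Sym2 U
  color : E → Fin n
  pref : E → E → Prop

/-- A sequence `C_1, …, C_p` of edge sets, given by its length `p = len` and the sets `set i` for
`1 ≤ i ≤ p`; the values of `set` at other arguments are never used. -/
structure EdgeChain (E : Type*) where
  len : ℕ
  set : ℕ → Finset E

namespace ColorfulGraph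

noncomputable section

open scoped Classical

variable {U E : Type*} {n : ℕ}

/-- No edge is a self-loop. -/
def Loopless (G : ColorfulGraph U E n) : Prop :=
  ∀ e, ¬ (G.ends e).IsDiag

/-- Every agent `i` ranks the edges of colour `i` by a linear order with ties
(`≻` is a strict weak order on every colour class). -/
def WeakRankings (G : ColorfulGraph U E n) : Prop :=
  ∀ i, IsStrictWeakOrder {e : E // G.color e = i} (fun e f => G.pref e f)

/-! ### Colourful forests and popularity -/

/-- `S` contains a cycle `x_0 e_0 x_1 e_1 … x_k e_k x_0` with distinct vertices and distinct edges
(the addition `j + 1` is modulo `k + 1`). -/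
def HasCycle (G : ColorfulGraph U E n) (S : Finset E) : Prop :=
  ∃ (k : ℕ) (x : Fin (k + 1) → U) (c : Fin (k + 1) → E),
    Function.Injective x ∧ Function.Injective c ∧
      ∀ j, c j ∈ S ∧ G.ends (c j) = s(x j, x (j + 1))

def IsForest (G : ColorfulGraph U E n) (S : Finset E) : Prop :=
  ¬ G.HasCycle S

/-- A forest with at most one edge of every colour. -/
def IsColorfulForest (G : ColorfulGraph U E n) (F : Finset E) : Prop :=
  G.IsForest F ∧ ∀ e ∈ F, ∀ f ∈ F, G.color e = G.color f → e = f

/-- Agent `i` prefers `F` to `F'`. -/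
def Prefers (G : ColorfulGraph U E n) (i : Fin n) (F F' : Finset E) : Prop :=
  ((∃ e ∈ F, G.color e = i) ∧ ∀ f ∈ F', G.color f ≠ i) ∨
    ∃ e ∈ F, ∃ f ∈ F', G.color e = i ∧ G.color f = i ∧ G.pref e f

/-- The number of agents that prefer `F` to `F'`. -/
def phi (G : ColorfulGraph U E n) (F F' : Finset E) : ℕ :=
  (Finset.univ.filter fun i => G.Prefers i F F').card

def IsPopularForest (G : ColorfulGraph U E n) (F : Finset E) : Prop :=
  G.IsColorfulForest F ∧ ∀ F', G.IsColorfulForest F' → G.phi F' F ≤ G.phi F F'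

/-- The convex hull of the incidence vectors of the popular colourful forests. -/
def popularForestPolytope (G : ColorfulGraph U E n) : Set (E → ℝ) :=
  convexHull ℝ {x | ∃ F : Finset E, G.IsPopularForest F ∧ x = Set.indicator (↑F : Set E) 1}

/-! ### The padded instance -/

/-- The padded instance: for every colour `i` a new edge `e_i = Sum.inr i` of colour `i` between two
new vertices is added, and `e_i` is the worst edge of agent `i`. -/
def padded (H : ColorfulGraph U E n) : ColorfulGraph (U ⊕ (Fin n ⊕ Fin n)) (E ⊕ Fin n) n where
  ends := Sum.elim (fun e => (H.ends e).map Sum.inl)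
    (fun i => s(Sum.inr (Sum.inl i), Sum.inr (Sum.inr i)))
  color := Sum.elim H.color id
  pref
    | Sum.inl e, Sum.inl f => H.pref e f
    | Sum.inl e, Sum.inr i => H.color e = i
    | Sum.inr _, _ => False

/-! ### The `n`-truncation of the graphic matroid -/

/-- Independence in the `n`-truncation of the graphic matroid, `n` being the number of colours. -/
def Indep (G : ColorfulGraph U E n) (S : Finset E) : Prop :=
  G.IsForest S ∧ S.card ≤ n

/-- The rank function of the truncation: the maximum size of an independent subset. -/
def rank (G : ColorfulGraph U E n) (S : Finset E) : ℕ :=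
  (S.powerset.filter fun T => G.Indep T).sup Finset.card

/-- A common independent set of the partition matroid of the colour classes and of the truncation. -/
def IsCommonIndep (G : ColorfulGraph U E n) (I : Finset E) : Prop :=
  G.Indep I ∧ ∀ e ∈ I, ∀ f ∈ I, G.color e = G.color f → e = f

/-- A colourful base: a colourful forest with exactly `n` edges. -/
def IsColorfulBase (G : ColorfulGraph U E n) (F : Finset E) : Prop :=
  G.IsColorfulForest F ∧ F.card = n

/-! ### Levels and the edge set of a chain -/

/-- The level of `e`: the least `i ∈ {1, …, p}` with `e ∈ C_i`. -/
def lev (C : EdgeChain E) (e : E) : ℕ :=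
  sInf {i | 1 ≤ i ∧ i ≤ C.len ∧ e ∈ C.set i}

variable [Fintype E]

/-- The span of `S` in the truncation. -/
def span (G : ColorfulGraph U E n) (S : Finset E) : Finset E :=
  Finset.univ.filter fun e => G.rank (insert e S) = G.rank S

/-- The highest level of an edge of colour `i`. -/
def levStar (G : ColorfulGraph U E n) (C : EdgeChain E) (i : Fin n) : ℕ :=
  (Finset.univ.filter fun e => G.color e = i).sup (lev C)

/-- The edge set `E(𝒞)`. -/
def edgesOf (G : ColorfulGraph U E n) (C : EdgeChain E) : Finset E :=
  Finset.univ.filter fun e =>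
    (lev C e = G.levStar C (G.color e) ∧
      ∀ f, G.color f = G.color e → lev C f = G.levStar C (G.color e) → ¬ G.pref f e) ∨
    (lev C e + 1 = G.levStar C (G.color e) ∧
      (∀ f, G.color f = G.color e → lev C f + 1 = G.levStar C (G.color e) → ¬ G.pref f e) ∧
      ∀ f, G.color f = G.color e → lev C f = G.levStar C (G.color e) → G.pref e f)

/-- `𝒞` is a dual certificate of the colourful base `F`:
`∅ ⊊ C_1 ⊊ ⋯ ⊊ C_p = E`, `F ⊆ E(𝒞)` and `span (F ∩ C_i) = C_i` for all `i`. -/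
structure IsDualCertificate (G : ColorfulGraph U E n) (F : Finset E) (C : EdgeChain E) : Prop where
  base : G.IsColorfulBase F
  one_le_len : 1 ≤ C.len
  first_nonempty : (C.set 1).Nonempty
  strict : ∀ i, 1 ≤ i → i < C.len → C.set i ⊂ C.set (i + 1)
  last : C.set C.len = Finset.univ
  subset : F ⊆ G.edgesOf C
  span_eq : ∀ i, 1 ≤ i → i ≤ C.len → G.span (F ∩ C.set i) = C.set i

/-! ### The popular common base algorithm -/

/-- `J` is lexicographically better than `I`:
`(|I ∩ C_1|, …, |I ∩ C_p|) < (|J ∩ C_1|, …, |J ∩ C_p|)` lexicographically. -/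
def LexBetter (C : EdgeChain E) (J I : Finset E) : Prop :=
  ∃ j, 1 ≤ j ∧ j ≤ C.len ∧ (∀ i, 1 ≤ i → i < j → (J ∩ C.set i).card = (I ∩ C.set i).card) ∧
    (I ∩ C.set j).card < (J ∩ C.set j).card

/-- `I` is a lexicographically maximal common independent set inside `E(𝒞)`. -/
def IsLexMax (G : ColorfulGraph U E n) (C : EdgeChain E) (I : Finset E) : Prop :=
  (G.IsCommonIndep I ∧ I ⊆ G.edgesOf C) ∧
    ∀ J, G.IsCommonIndep J → J ⊆ G.edgesOf C → ¬ LexBetter C J I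

/-- The initial chain `{E}`. -/
def initial : EdgeChain E where
  len := 1
  set := fun _ => Finset.univ

/-- The update of `𝒞` at the index `k`: `C_k` becomes `span (I ∩ C_k)`, and if `k = p` then `E` is
appended as `C_{p+1}`. -/
def update (G : ColorfulGraph U E n) (C : EdgeChain E) (I : Finset E) (k : ℕ) : EdgeChain E where
  len := if k = C.len then C.len + 1 else C.len
  set := fun i =>
    if i = k then G.span (I ∩ C.set k)
    else if k = C.len ∧ i = C.len + 1 then Finset.univ
    else C.set i

/-- `𝒞` occurs as the current multichain at the head of the `while` loop in some run of the
algorithm (the lexicographically maximal set is an arbitrary choice of the run). -/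
inductive Reachable (G : ColorfulGraph U E n) : EdgeChain E → Prop
  | init : Reachable G initial
  | step (C : EdgeChain E) (I : Finset E) (k : ℕ) :
      Reachable G C → C.len ≤ n → G.IsLexMax C I →
      1 ≤ k → k ≤ C.len →
      (∀ i, 1 ≤ i → i < k → (I ∩ C.set i).card = G.rank (C.set i)) →
      (I ∩ C.set k).card < G.rank (C.set k) →
      Reachable G (G.update C I k)

/-- Some run of the algorithm returns `F` while its current multichain is `𝒞`. -/
def Returns (G : ColorfulGraph U E n) (F : Finset E) (C : EdgeChain E) : Prop :=
  G.Reachable C ∧ C.len ≤ n ∧ G.IsLexMax C F ∧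
    ∀ i, 1 ≤ i → i ≤ C.len → (F ∩ C.set i).card = G.rank (C.set i)

/-! ### The linear description -/

/-- The matroid intersection constraints for common bases. -/
def commonBasePolytope (G : ColorfulGraph U E n) : Set (E → ℝ) :=
  {x | (∀ i, ∑ e ∈ Finset.univ.filter (fun e => G.color e = i), x e = 1) ∧
    (∀ S : Finset E, ∑ e ∈ S, x e ≤ (G.rank S : ℝ)) ∧
    ∀ e, 0 ≤ x e}

/-- The face of the common base polytope cut out by `∑_{e ∈ C} x_e = rank(C)` for all `C ∈ 𝒞` and
`x_e = 0` for all `e ∉ E(𝒞)`. -/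
def chainFace (G : ColorfulGraph U E n) (C : EdgeChain E) : Set (E → ℝ) :=
  {x | x ∈ G.commonBasePolytope ∧
    (∀ i, 1 ≤ i → i ≤ C.len → ∑ e ∈ C.set i, x e = (G.rank (C.set i) : ℝ)) ∧
    ∀ e, e ∉ G.edgesOf C → x e = 0}

end

end ColorfulGraph

/-! Certificates are dual solutions. Let vote(e, f) be 1, 0 or -1 according to the agent's
comparison of e with f. Then f ∈ E(𝒞) says precisely that vote(e, f) ≤ lev f - lev e for every e of
the colour of f. Summing over the colours gives weak duality: a base F that lies in E(𝒞) and spans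
every C_i minimizes the total level, so no colourful base beats it, and a tie forces equality
everywhere (`IsWeakCertificate.slackness`). Conversely, every popular base has a certificate: weight
splitting for the weights vote(·, F) gives a potential on the colours, and the superlevel sets of
the modified weight span the chain (`exists_weight_splitting`, `exists_isWeakCertificate`).

The algorithm only shrinks sets when it must: an exchange argument shows that its multichain stays
above every certificate of every base (`subset_span_of_isLexMax`, `Reachable.le_certificate`). The
returned multichain is itself a certificate, hence a shortest one. A shortest certificate has at
most two sets, because an edge of level 1 in F that is not a padding edge confines the padding edge
of its colour to level at most 2, while that padding edge lies outside every proper set of the chain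
(`IsWeakCertificate.len_le_two`).

For another popular base B, the slackness conditions for the returned 𝒞 and for a shortest
certificate of B are compared. With only two levels, an edge of B whose levels differ must tie with
the edge of F of its colour and inherits membership in E(𝒞) from it (`Returns.isPopularBase_iff`).
So the popular bases are the colourful bases on one face of the common base polytope. That polytope
is integral, again by weight splitting, so the face is the hull of the popular bases. Padding a
forest with the missing e_i preserves all votes, and forgetting the padding coordinates undoes it.
-/

namespace ColorfulGraph

noncomputable section

open scoped Classical

variable {U E : Type*} {n : ℕ}

/-! ### The graphic matroid is binary -/

/-- The incidence vector of an edge over the field with two elements. -/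
def incVec (G : ColorfulGraph U E n) (e : E) : U →₀ ZMod 2 :=
  Sym2.lift ⟨fun a b => Finsupp.single a 1 + Finsupp.single b 1, fun _ _ => add_comm _ _⟩ (G.ends e)

theorem incVec_of_ends (G : ColorfulGraph U E n) {e : E} {a b : U} (h : G.ends e = s(a, b)) :
    G.incVec e = Finsupp.single a 1 + Finsupp.single b 1 := by
  simp [incVec, h]

/-- Every vertex of a cycle is counted twice, so the incidence vectors along it sum to zero. -/
theorem not_linearIndepOn_of_hasCycle (G : ColorfulGraph U E n) {S : Finset E}
    (h : G.HasCycle S) : ¬ LinearIndepOn (ZMod 2) G.incVec (S : Set E) := by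
  obtain ⟨k, x, c, -, hc, hS⟩ := h
  intro hli
  have hli' : LinearIndependent (ZMod 2) (fun j => G.incVec (c j)) :=
    LinearIndependent.comp hli (fun j => (⟨c j, (hS j).1⟩ : (S : Set E)))
      fun i j hij => hc (by simpa using hij)
  have hsum : ∑ j, (1 : ZMod 2) • G.incVec (c j) = 0 := by
    simp only [one_smul, G.incVec_of_ends (hS _).2, Finset.sum_add_distrib]
    rw [show ∑ j, Finsupp.single (x (j + 1)) (1 : ZMod 2) = ∑ j, Finsupp.single (x j) 1 from
      Equiv.sum_comp (Equiv.addRight (1 : Fin (k + 1))) fun j => Finsupp.single (x j) (1 : ZMod 2)]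
    ext u
    simp only [Finsupp.add_apply, Finsupp.zero_apply]
    exact CharTwo.add_self_eq_zero _
  have := Fintype.linearIndependent_iff.1 hli' (fun _ => 1) hsum 0
  exact one_ne_zero this

/-- The simple graph underlying an edge set. -/
def underlying (G : ColorfulGraph U E n) (S : Finset E) : SimpleGraph U where
  Adj a b := a ≠ b ∧ ∃ f ∈ S, G.ends f = s(a, b)
  symm := ⟨fun _ _ h => ⟨h.1.symm, h.2.imp fun _ hf => ⟨hf.1, hf.2.trans Sym2.eq_swap⟩⟩⟩
  loopless := ⟨fun _ h => h.1 rfl⟩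

/-- The functional counting, modulo 2, the ends in the component of `a` kills every edge of `S`. It
would be 1 on `e` if `b` were in another component. -/
theorem reachable_of_incVec_mem_span (G : ColorfulGraph U E n) {S : Finset E} {e : E} {a b : U}
    (he : G.ends e = s(a, b))
    (h : G.incVec e ∈ Submodule.span (ZMod 2) (G.incVec '' (S : Set E))) :
    (G.underlying S).Reachable a b := by
  by_contra hab
  let φ : (U →₀ ZMod 2) →ₗ[ZMod 2] ZMod 2 :=
    Finsupp.linearCombination (ZMod 2) fun u => if (G.underlying S).Reachable a u then 1 else 0
  have hφ : ∀ y ∈ Submodule.span (ZMod 2) (G.incVec '' (S : Set E)), φ y = 0 := by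
    intro y hy
    have : Submodule.span (ZMod 2) (G.incVec '' (S : Set E)) ≤ LinearMap.ker φ := by
      rw [Submodule.span_le]
      rintro _ ⟨f, hf, rfl⟩
      obtain ⟨⟨u, v⟩, huv⟩ := Sym2.mk_surjective (G.ends f)
      have huv' : (G.underlying S).Reachable a u ↔ (G.underlying S).Reachable a v := by
        by_cases huv'' : u = v
        · rw [huv'']
        · have hadj : (G.underlying S).Adj u v := ⟨huv'', f, hf, huv.symm⟩
          exact ⟨fun h => h.trans hadj.reachable, fun h => h.trans hadj.symm.reachable⟩
      simp only [SetLike.mem_coe, LinearMap.mem_ker, G.incVec_of_ends huv.symm, map_add, φ,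
        Finsupp.linearCombination_single, huv', one_smul]
      exact CharTwo.add_self_eq_zero _
    exact this hy
  have h0 := hφ _ h
  simp only [G.incVec_of_ends he, map_add, φ, Finsupp.linearCombination_single, hab, one_smul,
    SimpleGraph.Reachable.refl, if_true, if_false, add_zero] at h0
  exact one_ne_zero h0

theorem hasCycle_insert_of_reachable (G : ColorfulGraph U E n) {S : Finset E} {e : E} (heS : e ∉ S)
    {a b : U} (he : G.ends e = s(a, b)) (h : (G.underlying S).Reachable a b) :
    G.HasCycle (insert e S) := by
  obtain ⟨p, hp⟩ := h.exists_isPath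
  have hex : ∀ m, m < p.length → ∃ f ∈ S, G.ends f = s(p.getVert m, p.getVert (m + 1)) :=
    fun m hm => (p.adj_getVert_succ hm).2
  have : Nonempty E := ⟨e⟩
  choose! g hgS hg using hex
  refine ⟨p.length, fun j => p.getVert j, fun j => if (j : ℕ) < p.length then g j else e, ?_, ?_, ?_⟩
  · intro i j hij
    exact Fin.ext (hp.getVert_injOn (show (i : ℕ) ≤ _ by omega) (show (j : ℕ) ≤ _ by omega) hij)
  · intro i j hij
    have hinj : ∀ {s t : ℕ}, s ≤ p.length → t ≤ p.length → p.getVert s = p.getVert t → s = t :=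
      fun hs ht => hp.getVert_injOn hs ht
    simp only at hij
    split_ifs at hij with hi hj hj
    · have h1 := hg i hi
      rw [hij, hg j hj] at h1
      rw [Sym2.eq_iff] at h1
      -- Two steps along the same edge either start at the same vertex or are reversed; the latter
      -- would give i = j + 1 and j = i + 1.
      rcases h1 with ⟨h1, -⟩ | ⟨h1, h2⟩
      · exact Fin.ext (hinj (by omega) (by omega) h1).symm
      · have := hinj (by omega) (by omega) h1
        have := hinj (by omega) (by omega) h2
        omega
    · exact absurd (hij ▸ hgS i hi) heS
    · exact absurd (hij ▸ hgS j hj) heS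
    · exact Fin.ext (by omega)
  · intro j
    dsimp only
    split_ifs with hj
    · have hj1 : ((j + 1 : Fin (p.length + 1)) : ℕ) = j + 1 :=
        Fin.val_add_one_of_lt (Fin.lt_def.2 (by simpa using hj))
      rw [hj1]
      exact ⟨Finset.mem_insert_of_mem (hgS j hj), hg j hj⟩
    · have hj1 : j = Fin.last p.length := Fin.ext (by simp; omega)
      subst hj1
      simp only [Fin.last_add_one, Fin.val_last, Fin.val_zero, SimpleGraph.Walk.getVert_length,
        SimpleGraph.Walk.getVert_zero]
      exact ⟨Finset.mem_insert_self _ _, he.trans Sym2.eq_swap⟩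

theorem HasCycle.mono {G : ColorfulGraph U E n} {S T : Finset E} (hST : S ⊆ T)
    (h : G.HasCycle S) : G.HasCycle T := by
  obtain ⟨k, x, c, hx, hc, hS⟩ := h
  exact ⟨k, x, c, hx, hc, fun j => ⟨hST (hS j).1, (hS j).2⟩⟩

theorem IsForest.mono {G : ColorfulGraph U E n} {S T : Finset E} (hST : S ⊆ T)
    (h : G.IsForest T) : G.IsForest S :=
  fun hS => h (hS.mono hST)

theorem isForest_iff_linearIndepOn (G : ColorfulGraph U E n) (S : Finset E) :
    G.IsForest S ↔ LinearIndepOn (ZMod 2) G.incVec (S : Set E) := by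
  refine ⟨fun h => ?_, fun h hc => G.not_linearIndepOn_of_hasCycle hc h⟩
  induction S using Finset.induction_on with
  | empty => simp
  | insert e S heS ih =>
    rw [Finset.coe_insert]
    refine (ih (h.mono (Finset.subset_insert _ _))).insert fun hmem => h ?_
    obtain ⟨⟨a, b⟩, hab⟩ := Sym2.mk_surjective (G.ends e)
    exact G.hasCycle_insert_of_reachable heS hab.symm
      (G.reachable_of_incVec_mem_span hab.symm hmem)

theorem isForest_empty (G : ColorfulGraph U E n) : G.IsForest ∅ := by
  simp [isForest_iff_linearIndepOn]

/-- The augmentation axiom by dimension: otherwise the span of `J` lies in that of `I`. -/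
theorem IsForest.exists_insert {G : ColorfulGraph U E n} {I J : Finset E} (hI : G.IsForest I)
    (hJ : G.IsForest J) (hIJ : I.card < J.card) : ∃ e ∈ J, e ∉ I ∧ G.IsForest (insert e I) := by
  rw [isForest_iff_linearIndepOn] at hI hJ
  by_contra! hcon
  have hcon' : ∀ e ∈ J, G.incVec e ∈ Submodule.span (ZMod 2) (G.incVec '' (I : Set E)) := by
    intro e he
    by_contra hmem
    have heI : e ∉ I := fun heI => hmem (Submodule.subset_span ⟨e, heI, rfl⟩)
    refine hcon e he heI ((G.isForest_iff_linearIndepOn _).2 ?_)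
    rw [Finset.coe_insert]
    exact hI.insert hmem
  have hle : Submodule.span (ZMod 2) (G.incVec '' (J : Set E)) ≤
      Submodule.span (ZMod 2) (G.incVec '' (I : Set E)) := by
    rw [Submodule.span_le]
    rintro _ ⟨e, he, rfl⟩
    exact hcon' e he
  have hcard : ∀ S : Finset E, LinearIndepOn (ZMod 2) G.incVec (S : Set E) →
      Module.finrank (ZMod 2) (Submodule.span (ZMod 2) (G.incVec '' (S : Set E))) = S.card := by
    intro S hS
    have := finrank_span_eq_card (R := ZMod 2) (b := fun e : (S : Set E) => G.incVec e) hS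
    rw [Set.image_eq_range]
    simpa using this
  have : FiniteDimensional (ZMod 2) (Submodule.span (ZMod 2) (G.incVec '' (I : Set E))) :=
    FiniteDimensional.span_of_finite _ (I.finite_toSet.image _)
  have := Submodule.finrank_mono hle
  rw [hcard I hI, hcard J hJ] at this
  omega

/-! ### The truncation as a matroid -/

theorem Indep.mono {G : ColorfulGraph U E n} {S T : Finset E} (hST : S ⊆ T)
    (h : G.Indep T) : G.Indep S :=
  ⟨h.1.mono hST, (Finset.card_le_card hST).trans h.2⟩

/-- The `n`-truncation of the graphic matroid. -/
def truncation (G : ColorfulGraph U E n) : Matroid E :=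
  (IndepMatroid.ofFinset Set.univ G.Indep ⟨G.isForest_empty, by simp⟩
    (fun _ _ hJ hIJ => hJ.mono hIJ)
    (fun I J hI hJ hIJ => by
      obtain ⟨e, heJ, heI, he⟩ := hI.1.exists_insert hJ.1 hIJ
      refine ⟨e, heJ, heI, he, ?_⟩
      rw [Finset.card_insert_of_notMem heI]
      exact hIJ.trans_le hJ.2)
    (fun _ _ => Set.subset_univ _)).matroid

@[simp]
theorem truncation_indep (G : ColorfulGraph U E n) {S : Finset E} :
    G.truncation.Indep (S : Set E) ↔ G.Indep S := by
  unfold truncation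
  rw [IndepMatroid.matroid_Indep]
  exact IndepMatroid.ofFinset_indep Set.univ G.Indep _ _ _ _

theorem le_rank (G : ColorfulGraph U E n) {S T : Finset E} (hT : G.Indep T) (hTS : T ⊆ S) :
    T.card ≤ G.rank S :=
  Finset.le_sup (f := Finset.card) (by simp [hT, hTS])

theorem exists_card_eq_rank (G : ColorfulGraph U E n) (S : Finset E) :
    ∃ T ⊆ S, G.Indep T ∧ T.card = G.rank S := by
  have hne : (S.powerset.filter fun T => G.Indep T).Nonempty :=
    ⟨∅, Finset.mem_filter.2 ⟨Finset.empty_mem_powerset _, G.isForest_empty, by simp⟩⟩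
  obtain ⟨T, hT, hTS⟩ := Finset.exists_mem_eq_sup _ hne Finset.card
  simp only [Finset.mem_filter, Finset.mem_powerset] at hT
  exact ⟨T, hT.1, hT.2, hTS.symm⟩

theorem eRk_truncation (G : ColorfulGraph U E n) (S : Finset E) :
    G.truncation.eRk (S : Set E) = G.rank S := by
  apply le_antisymm
  · rw [Matroid.eRk_le_iff]
    intro I hIS hI
    lift I to Finset E using S.finite_toSet.subset hIS
    rw [truncation_indep] at hI
    rw [Set.encard_coe_eq_coe_finsetCard]
    exact_mod_cast G.le_rank hI (by exact_mod_cast hIS)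
  · obtain ⟨T, hTS, hT, hc⟩ := G.exists_card_eq_rank S
    rw [Matroid.le_eRk_iff]
    exact ⟨T, by exact_mod_cast hTS, G.truncation_indep.2 hT, by
      rw [Set.encard_coe_eq_coe_finsetCard, hc]⟩

variable [Fintype E]

theorem mem_span_iff (G : ColorfulGraph U E n) {S : Finset E} {e : E} :
    e ∈ G.span S ↔ e ∈ G.truncation.closure (S : Set E) := by
  have h : e ∈ G.span S ↔
      G.truncation.eRk (insert e (S : Set E)) = G.truncation.eRk (S : Set E) := by
    rw [← Finset.coe_insert, eRk_truncation, eRk_truncation]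
    simp [span]
  rw [h]
  constructor
  · intro heq
    by_contra hcl
    have := Matroid.eRk_insert_eq_add_one (M := G.truncation) ⟨Set.mem_univ e, hcl⟩
    rw [heq, eRk_truncation] at this
    have : G.rank S = G.rank S + 1 := by exact_mod_cast this
    omega
  · intro hcl
    rw [← Matroid.eRk_closure_eq, Matroid.closure_insert_eq_of_mem_closure hcl,
      Matroid.eRk_closure_eq]

theorem coe_span (G : ColorfulGraph U E n) (S : Finset E) :
    (G.span S : Set E) = G.truncation.closure (S : Set E) :=
  Set.ext fun _ => G.mem_span_iff

theorem subset_span (G : ColorfulGraph U E n) (S : Finset E) : S ⊆ G.span S := by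
  rw [← Finset.coe_subset, coe_span]
  exact Matroid.subset_closure _ _ (Set.subset_univ _)

theorem span_mono (G : ColorfulGraph U E n) {S T : Finset E} (h : S ⊆ T) :
    G.span S ⊆ G.span T := by
  rw [← Finset.coe_subset, coe_span, coe_span]
  exact Matroid.closure_subset_closure _ (by exact_mod_cast h)

theorem span_span (G : ColorfulGraph U E n) (S : Finset E) : G.span (G.span S) = G.span S := by
  rw [← Finset.coe_inj, coe_span, coe_span, Matroid.closure_closure]

theorem span_subset_span (G : ColorfulGraph U E n) {S T : Finset E} (h : S ⊆ G.span T) :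
    G.span S ⊆ G.span T :=
  (G.span_mono h).trans_eq (G.span_span T)

theorem Indep.insert_of_notMem_span {G : ColorfulGraph U E n} {S : Finset E} {e : E}
    (hS : G.Indep S) (he : e ∉ G.span S) : G.Indep (insert e S) := by
  rw [← truncation_indep, Finset.coe_insert]
  rw [mem_span_iff] at he
  exact ((G.truncation_indep.2 hS).notMem_closure_iff (Set.mem_univ e)).1 he |>.1

theorem Indep.notMem_span {G : ColorfulGraph U E n} {S : Finset E} {e : E}
    (hS : G.Indep (insert e S)) (he : e ∉ S) : e ∉ G.span S := by
  rw [mem_span_iff]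
  rw [← truncation_indep, Finset.coe_insert] at hS
  have := hS.notMem_closure_sdiff_of_mem (Set.mem_insert e _)
  rwa [Set.insert_sdiff_self_of_notMem (by exact_mod_cast he)] at this

/-- An independent subset of `S` of size `rank S` spans `S`. -/
theorem Indep.subset_span_of_rank_le {G : ColorfulGraph U E n} {S T : Finset E}
    (hT : G.Indep T) (hTS : T ⊆ S) (h : G.rank S ≤ T.card) : S ⊆ G.span T := by
  intro e he
  by_contra hsp
  have h1 := G.le_rank (hT.insert_of_notMem_span hsp) (Finset.insert_subset he hTS)
  rw [Finset.card_insert_of_notMem fun h => hsp (G.subset_span T h)] at h1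
  omega

theorem rank_span_of_indep (G : ColorfulGraph U E n) {T : Finset E} (hT : G.Indep T) :
    G.rank (G.span T) = T.card := by
  have h : (G.rank (G.span T) : ℕ∞) = T.card := by
    rw [← eRk_truncation, coe_span, Matroid.eRk_closure_eq,
      (G.truncation_indep.2 hT).eRk_eq_encard, Set.encard_coe_eq_coe_finsetCard]
  exact_mod_cast h

end

end ColorfulGraph

namespace ColorfulGraph

noncomputable section

open scoped Classical

variable {U E : Type*} {n : ℕ}

/-! ### Levels -/

/-- The preferences are asymmetric and negatively transitive on every colour class. -/
structure IsRanked (G : ColorfulGraph U E n) : Prop where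
  asymm : ∀ {e f}, G.color e = G.color f → G.pref e f → ¬ G.pref f e
  negTrans : ∀ {e f g}, G.color e = G.color f → G.color g = G.color f → G.pref e f →
    G.pref e g ∨ G.pref g f

/-- The chain is increasing and ends with the set of all edges. -/
structure _root_.EdgeChain.IsMultichain [Fintype E] (C : EdgeChain E) : Prop where
  one_le_len : 1 ≤ C.len
  mono : ∀ i, 1 ≤ i → i < C.len → C.set i ⊆ C.set (i + 1)
  last : C.set C.len = Finset.univ

theorem lev_le {C : EdgeChain E} {e : E} {i : ℕ} (h1 : 1 ≤ i) (h2 : i ≤ C.len)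
    (he : e ∈ C.set i) : lev C e ≤ i :=
  Nat.sInf_le ⟨h1, h2, he⟩

section Multichain

variable [Fintype E] {C D : EdgeChain E}

theorem _root_.EdgeChain.IsMultichain.lev_spec (hC : C.IsMultichain) (e : E) :
    1 ≤ lev C e ∧ lev C e ≤ C.len ∧ e ∈ C.set (lev C e) :=
  Nat.sInf_mem (s := {i | 1 ≤ i ∧ i ≤ C.len ∧ e ∈ C.set i})
    ⟨C.len, hC.one_le_len, le_rfl, by simp [hC.last]⟩

theorem _root_.EdgeChain.IsMultichain.subset (hC : C.IsMultichain) {i j : ℕ} (hi : 1 ≤ i)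
    (hij : i ≤ j) (hj : j ≤ C.len) : C.set i ⊆ C.set j := by
  induction j, hij using Nat.le_induction with
  | base => exact subset_rfl
  | succ j hij ih => exact (ih (by omega)).trans (hC.mono j (by omega) (by omega))

theorem _root_.EdgeChain.IsMultichain.mem_iff (hC : C.IsMultichain) {i : ℕ} (hi : 1 ≤ i)
    (hi' : i ≤ C.len) {e : E} : e ∈ C.set i ↔ lev C e ≤ i := by
  refine ⟨lev_le hi hi', fun h => ?_⟩
  obtain ⟨h1, -, h3⟩ := hC.lev_spec e
  exact hC.subset h1 h hi' h3

theorem lev_le_levStar (G : ColorfulGraph U E n) (C : EdgeChain E) {e : E} {i : Fin n}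
    (h : G.color e = i) : lev C e ≤ G.levStar C i :=
  Finset.le_sup (f := lev C) (by simp [h])

theorem exists_lev_eq_levStar (G : ColorfulGraph U E n) (C : EdgeChain E) (e : E) :
    ∃ f, G.color f = G.color e ∧ lev C f = G.levStar C (G.color e) := by
  obtain ⟨f, hf, h⟩ := Finset.exists_mem_eq_sup
    (Finset.univ.filter fun f => G.color f = G.color e) ⟨e, by simp⟩ (lev C)
  exact ⟨f, by simpa using hf, h.symm⟩

/-- This removes the top level of the colour from the definition and leaves pairwise conditions,
which are what the comparison of chains and the duality argument need. -/
theorem mem_edgesOf_iff (G : ColorfulGraph U E n) {C : EdgeChain E} {e : E} :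
    e ∈ G.edgesOf C ↔ ∀ f, G.color f = G.color e → lev C f ≤ lev C e + 1 ∧
      (lev C f = lev C e + 1 → G.pref e f) ∧ (lev C f = lev C e → ¬ G.pref f e) := by
  have hle := G.lev_le_levStar C (e := e) rfl
  simp only [edgesOf, Finset.mem_filter, Finset.mem_univ, true_and]
  constructor
  · rintro (⟨h1, h2⟩ | ⟨h1, h2, h3⟩) f hf
    · have := G.lev_le_levStar C hf
      exact ⟨by omega, fun h => by omega, fun h => h2 f hf (h.trans h1)⟩
    · have := G.lev_le_levStar C hf
      exact ⟨by omega, fun h => h3 f hf (h.trans h1), fun h => h2 f hf (by omega)⟩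
  · intro h
    obtain ⟨g, hg, hgL⟩ := G.exists_lev_eq_levStar C e
    have := (h g hg).1
    rcases Nat.lt_or_ge (lev C e) (G.levStar C (G.color e)) with hlt | hge
    · exact Or.inr ⟨by omega, fun f hf hfL => (h f hf).2.2 (by omega),
        fun f hf hfL => (h f hf).2.1 (by omega)⟩
    · exact Or.inl ⟨by omega, fun f hf hfL => (h f hf).2.2 (by omega)⟩

/-- Passing from `D` to `C` can only lower the levels of the competitors of `e`, which weakens the
conditions on `e`. A competitor falling from one level above to the level of `e` was already worse
than `e`. -/
theorem mem_edgesOf_of_lev_eq {G : ColorfulGraph U E n} (hG : G.IsRanked)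
    (hle : ∀ e, lev C e ≤ lev D e) {e : E} (he : e ∈ G.edgesOf D) (h : lev C e = lev D e) :
    e ∈ G.edgesOf C := by
  rw [mem_edgesOf_iff] at he ⊢
  intro f hf
  obtain ⟨h1, h2, h3⟩ := he f hf
  have := hle f
  refine ⟨by omega, fun h' => h2 (by omega), fun h' => ?_⟩
  rcases Nat.lt_or_ge (lev D e) (lev D f) with hlt | hge
  · exact hG.asymm hf.symm (h2 (by omega))
  · exact h3 (by omega)

/-- If the level of `f` were smaller in `C` than in `D`, the two memberships would ask for
contradictory preferences between `e` and `f`. In the exchange argument `f` is the edge displaced by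
`e`. -/
theorem lev_eq_of_mem_edgesOf {G : ColorfulGraph U E n} (hG : G.IsRanked)
    (hle : ∀ e, lev C e ≤ lev D e) {e f : E} (hef : G.color f = G.color e) (he : e ∈ G.edgesOf D)
    (h : lev C e = lev D e) (hf : f ∈ G.edgesOf C) : lev D f = lev C f := by
  rw [mem_edgesOf_iff] at he hf
  obtain ⟨h1, h2, h3⟩ := he f hef
  obtain ⟨h4, h5, h6⟩ := hf e hef.symm
  have := hle f
  by_contra hne
  rcases Nat.lt_or_ge (lev C f) (lev C e) with hlt | hge
  · have hfe := h5 (by omega)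
    rcases Nat.lt_or_ge (lev D e) (lev D f) with hlt' | hge'
    · exact hG.asymm hef hfe (h2 (by omega))
    · exact h3 (by omega) hfe
  · exact h6 (by omega) (h2 (by omega))

end Multichain

/-! ### Certificates whose sets may coincide, and the invariant of the algorithm -/

theorem IsColorfulBase.indep {G : ColorfulGraph U E n} {F : Finset E} (hF : G.IsColorfulBase F) :
    G.Indep F :=
  ⟨hF.1.1, hF.2.le⟩

theorem card_insert_erase_inter {J X : Finset E} {e f : E} (he : e ∉ J) (hf : f ∈ J) :
    (insert e (J.erase f) ∩ X).card + (if f ∈ X then 1 else 0) =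
      (J ∩ X).card + (if e ∈ X then 1 else 0) := by
  have h1 : (insert e (J.erase f) ∩ X).card =
      ((J.erase f) ∩ X).card + (if e ∈ X then 1 else 0) := by
    split_ifs with h
    · rw [Finset.insert_inter_of_mem h, Finset.card_insert_of_notMem (by simp [he])]
    · rw [Finset.insert_inter_of_notMem h, add_zero]
  have h2 : (J ∩ X).card = ((J.erase f) ∩ X).card + (if f ∈ X then 1 else 0) := by
    conv_lhs => rw [← Finset.insert_erase hf]
    split_ifs with h
    · rw [Finset.insert_inter_of_mem h, Finset.card_insert_of_notMem (by simp)]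
    · rw [Finset.insert_inter_of_notMem h, add_zero]
  omega

section Certificate

variable [Fintype E]

/-- A dual certificate whose sets are only required to be increasing. -/
structure IsWeakCertificate (G : ColorfulGraph U E n) (F : Finset E) (C : EdgeChain E) : Prop
    extends C.IsMultichain where
  base : G.IsColorfulBase F
  subset : F ⊆ G.edgesOf C
  span_eq : ∀ i, 1 ≤ i → i ≤ C.len → G.span (F ∩ C.set i) = C.set i

theorem IsWeakCertificate.rank_eq {G : ColorfulGraph U E n} {F : Finset E} {C : EdgeChain E}
    (h : G.IsWeakCertificate F C) {i : ℕ} (h1 : 1 ≤ i) (h2 : i ≤ C.len) :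
    G.rank (C.set i) = (F ∩ C.set i).card := by
  conv_lhs => rw [← h.span_eq i h1 h2]
  exact G.rank_span_of_indep (h.base.indep.mono Finset.inter_subset_left)

/-- The exchange argument behind the correctness of the algorithm: `J` falls short of the ranks of
the chain by at most one, from level `j` on. -/
theorem subset_span_of_isLexMax {G : ColorfulGraph U E n} (hG : G.IsRanked) {F I : Finset E}
    {C D : EdgeChain E} (hC : C.IsMultichain) (hD : G.IsWeakCertificate F D)
    (hle : ∀ e, lev C e ≤ lev D e) (hlen : C.len ≤ D.len) (hI : G.IsLexMax C I) {k : ℕ}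
    (hk1 : 1 ≤ k) (hk : k ≤ C.len)
    (hIrank : ∀ i, 1 ≤ i → i < k → (I ∩ C.set i).card = G.rank (C.set i)) (J : Finset E) (j : ℕ)
    (hJk : J ⊆ C.set k) (hJ : G.IsCommonIndep J) (hJC : J ⊆ G.edgesOf C) (hj : 1 ≤ j) (hjk : j ≤ k)
    (hJrank : ∀ i, 1 ≤ i → i < k →
      G.rank (C.set i) ≤ (J ∩ C.set i).card + (if j ≤ i then 1 else 0))
    (hIJ : (I ∩ C.set k).card ≤ J.card) : D.set j ⊆ G.span J := by
  by_contra hspan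
  obtain ⟨e, he, heJ⟩ : ∃ e ∈ F ∩ D.set j, e ∉ G.span J := by
    by_contra! h
    rw [← hD.span_eq j hj (by omega)] at hspan
    exact hspan (G.span_subset_span h)
  rw [Finset.mem_inter] at he
  have heJ' : e ∉ J := fun h => heJ (G.subset_span J h)
  -- Below index `j` there is no deficit, so `J` spans those `C_i`; as `e` is not spanned, its level
  -- in `C` is at least `j`.
  have hlevC : lev C e = j ∧ lev D e = j := by
    have h1 := lev_le hj (by omega) he.2
    have h2 := hle e
    have h3 : j ≤ lev C e := by
      by_contra! hlt
      obtain ⟨h4, -, h5⟩ := hC.lev_spec e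
      have h6 := hJrank _ h4 (by omega)
      rw [if_neg (by omega), add_zero] at h6
      exact heJ (G.span_mono Finset.inter_subset_left
        ((hJ.1.mono Finset.inter_subset_left).subset_span_of_rank_le
          Finset.inter_subset_right h6 h5))
    omega
  have heC : e ∈ G.edgesOf C :=
    mem_edgesOf_of_lev_eq hG hle (hD.subset he.1) (hlevC.1.trans hlevC.2.symm)
  have hins : G.Indep (insert e J) := hJ.1.insert_of_notMem_span heJ
  have hmem : ∀ i, 1 ≤ i → i ≤ k → (e ∈ C.set i ↔ j ≤ i) := fun i h1 h2 => by
    rw [hC.mem_iff h1 (by omega), hlevC.1]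
  by_cases hcol : ∃ f ∈ J, G.color f = G.color e
  · obtain ⟨f, hfJ, hfe⟩ := hcol
    have hne : f ≠ e := fun h => heJ' (h ▸ hfJ)
    have hfF : f ∉ F := fun h => hne (hD.base.1.2 f h e he.1 hfe)
    have hfD : lev D f = lev C f :=
      lev_eq_of_mem_edgesOf hG hle hfe (hD.subset he.1) (by omega) (hJC hfJ)
    obtain ⟨hf1, -, hf2⟩ := hD.lev_spec f
    have hfk : lev C f ≤ k := lev_le hk1 hk (hJk hfJ)
    have hinsert : insert f (insert e (J.erase f)) = insert e J := by
      rw [Finset.insert_comm, Finset.insert_erase hfJ]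
    have hcard := fun X : Finset E => card_insert_erase_inter (X := X) heJ' hfJ
    have hsub : insert e (J.erase f) ⊆ insert e J :=
      Finset.insert_subset_insert _ (Finset.erase_subset _ _)
    -- Termination: the exchange brings in an edge of `F` and discards one outside `F`.
    have hdecr : (F \ insert e (J.erase f)).card < (F \ J).card := by
      have h1 := hcard F
      rw [if_neg hfF, if_pos he.1, Finset.inter_comm, Finset.inter_comm J] at h1
      have h2 := Finset.card_sdiff_add_card_inter F (insert e (J.erase f))
      have h3 := Finset.card_sdiff_add_card_inter F J
      omega
    -- Swapping `f` for `e` moves the start of the unit deficit from `j` to the level of `f`, so the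
    -- invariant persists. The recursive conclusion puts `f` in the span of `J - f + e`, although `J
    -- + e` is independent.
    have hrec := subset_span_of_isLexMax hG hC hD hle hlen hI hk1 hk hIrank
      (insert e (J.erase f)) (lev C f)
      (Finset.insert_subset ((hmem k hk1 le_rfl).2 hjk) ((Finset.erase_subset _ _).trans hJk))
      ⟨hins.mono hsub, by
        intro a ha b hb hab
        rw [Finset.mem_insert, Finset.mem_erase] at ha hb
        rcases ha with rfl | ⟨ha1, ha2⟩ <;> rcases hb with rfl | ⟨hb1, hb2⟩
        · rfl
        · exact absurd (hJ.2 b hb2 f hfJ (hab.symm.trans hfe.symm)) hb1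
        · exact absurd (hJ.2 a ha2 f hfJ (hab.trans hfe.symm)) ha1
        · exact hJ.2 a ha2 b hb2 hab⟩
      (Finset.insert_subset heC ((Finset.erase_subset _ _).trans hJC))
      (hC.lev_spec f).1 hfk
      (fun i h1 h2 => by
        have h3 := hJrank i h1 h2
        have h4 := hcard (C.set i)
        simp only [hmem i h1 h2.le, hC.mem_iff h1 (h2.le.trans hk)] at h4
        omega)
      (by
        have h := Finset.card_insert_of_notMem (s := J.erase f) (a := e) (by simp [heJ'])
        rw [h, Finset.card_erase_add_one hfJ]
        exact hIJ)
    rw [hfD] at hf2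
    refine Indep.notMem_span (S := insert e (J.erase f)) (e := f) ?_ (by simp [hne]) (hrec hf2)
    rwa [hinsert]
  -- If the colour of `e` is free, `J + e` fills the deficit at all indices below `k` and beats `I`
  -- at `k`.
  · push Not at hcol
    have hcommon : G.IsCommonIndep (insert e J) := by
      refine ⟨hins, ?_⟩
      intro a ha b hb hab
      rw [Finset.mem_insert] at ha hb
      rcases ha with rfl | ha <;> rcases hb with rfl | hb
      · rfl
      · exact absurd hab.symm (hcol b hb)
      · exact absurd hab (hcol a ha)
      · exact hJ.2 a ha b hb hab
    refine hI.2 _ hcommon (Finset.insert_subset heC hJC) ⟨k, hk1, hk, fun i h1 h2 => ?_, ?_⟩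
    · have h3 := hJrank i h1 h2
      rw [hIrank i h1 h2]
      apply le_antisymm (G.le_rank (hins.mono Finset.inter_subset_left) Finset.inter_subset_right)
      split_ifs at h3 with hji
      · rwa [Finset.insert_inter_of_mem ((hmem i h1 h2.le).2 hji),
          Finset.card_insert_of_notMem (by simp [heJ'])]
      · exact h3.trans (Finset.card_le_card
          (Finset.inter_subset_inter_right (Finset.subset_insert _ _)))
    · rw [Finset.inter_eq_left.2
        (Finset.insert_subset ((hmem k hk1 le_rfl).2 hjk) hJk), Finset.card_insert_of_notMem heJ']
      omega
termination_by (F \ J).card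

theorem isMultichain_initial : (initial : EdgeChain E).IsMultichain :=
  ⟨le_rfl, fun i h1 h2 => absurd h2 (by simp [initial]; omega), rfl⟩

theorem span_univ (G : ColorfulGraph U E n) : G.span Finset.univ = Finset.univ :=
  (Finset.subset_univ _).antisymm (G.subset_span _)

/-- The sets of a multichain reached by the algorithm are closed. -/
theorem Reachable.isMultichain {G : ColorfulGraph U E n} {C : EdgeChain E} (h : G.Reachable C) :
    C.IsMultichain ∧ ∀ i, 1 ≤ i → i ≤ C.len → G.span (C.set i) = C.set i := by
  induction h with
  | init => exact ⟨isMultichain_initial, fun _ _ _ => G.span_univ⟩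
  | step C I k _ _ hI hk1 hk hIrank hIk ih =>
    obtain ⟨hC, hcl⟩ := ih
    have hsub : G.span (I ∩ C.set k) ⊆ C.set k :=
      (G.span_mono Finset.inter_subset_right).trans_eq (hcl k hk1 hk)
    refine ⟨⟨?_, ?_, ?_⟩, ?_⟩
    · have := hC.one_le_len
      simp only [update]
      split_ifs <;> omega
    · intro i h1 h2
      simp only [update] at h2 ⊢
      -- The choice of `k` as the least deficient index makes `I` span the preceding set, so the new
      -- set still contains it.
      have hlow : i + 1 = k → C.set i ⊆ G.span (I ∩ C.set k) := by
        intro hik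
        refine ((hI.1.1.1.mono Finset.inter_subset_left).subset_span_of_rank_le
          Finset.inter_subset_right (hIrank i h1 (by omega)).ge).trans (G.span_mono ?_)
        exact Finset.inter_subset_inter_left (hC.subset h1 (by omega) hk)
      by_cases hkl : k = C.len
      · rw [if_pos hkl] at h2
        rcases Nat.lt_trichotomy i k with hik | hik | hik
        · rw [if_neg hik.ne, if_neg (by omega)]
          by_cases hik' : i + 1 = k
          · rw [if_pos hik']
            exact hlow hik'
          · rw [if_neg hik', if_neg (by omega)]
            exact hC.mono i h1 (by omega)
        · rw [if_neg (by omega : i + 1 ≠ k), if_pos (by omega : k = C.len ∧ i + 1 = C.len + 1)]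
          exact Finset.subset_univ _
        · omega
      · rw [if_neg hkl] at h2
        simp only [hkl, false_and, if_false]
        by_cases hik : i = k
        · rw [if_pos hik, if_neg (by omega)]
          exact hsub.trans (hik ▸ hC.mono i h1 h2)
        · rw [if_neg hik]
          split_ifs with hik'
          · exact hlow hik'
          · exact hC.mono i h1 h2
    · simp only [update]
      by_cases hkl : k = C.len
      · simp [hkl]
      · simp [hkl, Ne.symm hkl, hC.last]
    · intro i h1 h2
      simp only [update] at h2 ⊢
      by_cases hik : i = k
      · rw [if_pos hik, span_span]
      · rw [if_neg hik]
        by_cases hi : k = C.len ∧ i = C.len + 1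
        · rw [if_pos hi, span_univ]
        · rw [if_neg hi]
          exact hcl i h1 (by split_ifs at h2 <;> omega)

theorem lev_le_lev {C D : EdgeChain E} (hC : C.IsMultichain) (hD : D.IsMultichain)
    (h : ∀ i, 1 ≤ i → i ≤ C.len → D.set i ⊆ C.set i) (e : E) : lev C e ≤ lev D e := by
  obtain ⟨h1, -, h3⟩ := hD.lev_spec e
  by_cases hle : lev D e ≤ C.len
  · exact lev_le h1 hle (h _ h1 hle h3)
  · have := (hC.lev_spec e).2.1
    omega

/-- The multichain of the algorithm stays above every certificate. -/
theorem Reachable.le_certificate {G : ColorfulGraph U E n} (hG : G.IsRanked) {C D : EdgeChain E}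
    {F : Finset E} (h : G.Reachable C) (hD : G.IsWeakCertificate F D) :
    C.len ≤ D.len ∧ ∀ i, 1 ≤ i → i ≤ C.len → D.set i ⊆ C.set i := by
  induction h with
  | init => exact ⟨hD.one_le_len, fun _ _ _ => Finset.subset_univ _⟩
  | step C I k hreach _ hI hk1 hk hIrank hIk ih =>
    obtain ⟨hlen, hsub⟩ := ih
    obtain ⟨hC, hcl⟩ := hreach.isMultichain
    -- The exchange argument starts from `J = I ∩ C_k` and `j = k`, where no deficit occurs below
    -- `k`.
    have hkey : D.set k ⊆ G.span (I ∩ C.set k) := by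
      refine subset_span_of_isLexMax hG hC hD (lev_le_lev hC hD.toIsMultichain hsub) hlen hI hk1 hk
        hIrank (I ∩ C.set k) k Finset.inter_subset_right
        ⟨hI.1.1.1.mono Finset.inter_subset_left, fun a ha b hb => hI.1.1.2 a
          (Finset.mem_inter.1 ha).1 b (Finset.mem_inter.1 hb).1⟩
        (Finset.inter_subset_left.trans hI.1.2) hk1 le_rfl (fun i h1 h2 => ?_) le_rfl
      rw [if_neg (by omega), add_zero, Finset.inter_assoc,
        Finset.inter_eq_right.2 (hC.subset h1 h2.le hk)]
      exact (hIrank i h1 h2).ge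
    -- If `D` ended at `k = p` too, then `I` would span `E`, contrary to its deficit at `k`.
    have hlen' : k = C.len → C.len + 1 ≤ D.len := by
      intro hkl
      by_contra! hlt
      have hkD : k = D.len := by omega
      rw [hkD, hD.last, ← hkD] at hkey
      have h1 := G.rank_span_of_indep (hI.1.1.1.mono (Finset.inter_subset_left (s₂ := C.set k)))
      rw [Finset.univ_subset_iff.1 hkey] at h1
      rw [hkl, hC.last, ← hC.last, ← hkl] at h1
      rw [← h1, hkl, hC.last] at hIk
      exact lt_irrefl _ hIk
    refine ⟨?_, fun i h1 h2 => ?_⟩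
    · simp only [update]
      split_ifs with hkl
      · exact hlen' hkl
      · exact hlen
    · simp only [update] at h2 ⊢
      by_cases hik : i = k
      · rw [if_pos hik]
        exact hik ▸ hkey
      · rw [if_neg hik]
        by_cases hi : k = C.len ∧ i = C.len + 1
        · rw [if_pos hi]
          exact Finset.subset_univ _
        · rw [if_neg hi]
          exact hsub i h1 (by split_ifs at h2 <;> omega)

end Certificate

end

end ColorfulGraph

namespace ColorfulGraph

noncomputable section

open scoped Classical

variable {U E : Type*} {n : ℕ}

/-! ### Padded instances and shortest certificates -/

/-- The edges `b i` are isolated, and `b i` is the worst edge of agent `i`. -/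
structure IsPadding (G : ColorfulGraph U E n) (b : Fin n → E) : Prop where
  ranked : G.IsRanked
  color_eq : ∀ i, G.color (b i) = i
  worst : ∀ {e}, e ≠ b (G.color e) → G.pref e (b (G.color e))
  loopless : ∀ e, G.IsForest {e}
  coloop : ∀ {S} i, G.IsForest S → G.IsForest (insert (b i) S)

namespace IsPadding

variable {G : ColorfulGraph U E n} {b : Fin n → E}

theorem injective (hb : G.IsPadding b) : Function.Injective b := fun i j h => by
  rw [← hb.color_eq i, h, hb.color_eq]

theorem isForest_union (hb : G.IsPadding b) {S T : Finset E} (hS : G.IsForest S)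
    (hT : ∀ e ∈ T, ∃ i, e = b i) : G.IsForest (T ∪ S) := by
  induction T using Finset.induction_on with
  | empty => simpa using hS
  | insert e T _ ih =>
    obtain ⟨i, rfl⟩ := hT e (Finset.mem_insert_self _ _)
    rw [Finset.insert_union]
    exact hb.coloop i (ih fun f hf => hT f (Finset.mem_insert_of_mem hf))

theorem isForest_of_forall_mem (hb : G.IsPadding b) {S R : Finset E} (hS : G.IsForest S)
    (h : ∀ e ∈ R, e ∈ S ∨ ∃ i, e = b i) : G.IsForest R := by
  refine (hb.isForest_union (T := R.filter fun e => ∃ i, e = b i) hS fun e he =>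
    (Finset.mem_filter.1 he).2).mono fun e he => ?_
  rw [Finset.mem_union, Finset.mem_filter]
  exact (h e he).elim Or.inr fun h' => Or.inl ⟨he, h'⟩

theorem isColorfulBase_image (hb : G.IsPadding b) : G.IsColorfulBase (Finset.univ.image b) := by
  refine ⟨⟨?_, ?_⟩, ?_⟩
  · have := hb.isForest_union (T := Finset.univ.image b) G.isForest_empty fun e he => by
      obtain ⟨i, -, rfl⟩ := Finset.mem_image.1 he
      exact ⟨i, rfl⟩
    simpa using this
  · intro e he f hf hef
    obtain ⟨i, -, rfl⟩ := Finset.mem_image.1 he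
    obtain ⟨j, -, rfl⟩ := Finset.mem_image.1 hf
    rw [hb.color_eq, hb.color_eq] at hef
    rw [hef]
  · rw [Finset.card_image_of_injective _ hb.injective, Finset.card_univ, Fintype.card_fin]

theorem rank_univ [Fintype E] (hb : G.IsPadding b) : G.rank Finset.univ = n := by
  apply le_antisymm
  · obtain ⟨T, -, hT, h⟩ := G.exists_card_eq_rank Finset.univ
    exact h ▸ hT.2
  · have h := hb.isColorfulBase_image
    exact h.2.ge.trans (G.le_rank h.indep (Finset.subset_univ _))

theorem notMem_span [Fintype E] (hb : G.IsPadding b) {S : Finset E} (hS : G.Indep S)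
    (hcard : S.card < n) {i : Fin n} (hi : b i ∉ S) : b i ∉ G.span S :=
  Indep.notMem_span ⟨hb.coloop i hS.1, by rw [Finset.card_insert_of_notMem hi]; omega⟩ hi

theorem span_of_isColorfulBase [Fintype E] (hb : G.IsPadding b) {F : Finset E}
    (hF : G.IsColorfulBase F) : G.span F = Finset.univ :=
  Finset.univ_subset_iff.1 (hF.indep.subset_span_of_rank_le (Finset.subset_univ _)
    (by rw [hb.rank_univ, hF.2]))

variable [Fintype E]

theorem card_inter_lt (hb : G.IsPadding b) {F : Finset E} (hF : G.IsColorfulBase F) {X : Finset E}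
    (hX : G.span (F ∩ X) = X) (hne : X ≠ Finset.univ) : (F ∩ X).card < n := by
  by_contra! h
  have h1 : F ∩ X = F := Finset.eq_of_subset_of_card_le Finset.inter_subset_left (hF.2.trans_le h)
  rw [h1, hb.span_of_isColorfulBase hF] at hX
  exact hne hX.symm

end IsPadding

variable [Fintype E]

/-- A repeated final `E` affects no level. -/
theorem IsWeakCertificate.dropLast {G : ColorfulGraph U E n} {F : Finset E} {D : EdgeChain E}
    (hD : G.IsWeakCertificate F D) {p : ℕ} (hp : D.len = p + 1) (hp1 : 1 ≤ p)
    (hlast : D.set p = Finset.univ) : G.IsWeakCertificate F ⟨p, D.set⟩ := by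
  have hM : (⟨p, D.set⟩ : EdgeChain E).IsMultichain :=
    ⟨hp1, fun i h1 h2 => hD.mono i h1 (by simp only at h2; omega), hlast⟩
  have hlev : ∀ e, lev ⟨p, D.set⟩ e = lev D e := by
    intro e
    obtain ⟨h1, h2, h3⟩ := hD.lev_spec e
    obtain ⟨h4, h5, h6⟩ := hM.lev_spec e
    simp only at h5 h6
    have h7 : lev D e ≤ p := lev_le hp1 (by omega) (by simp [hlast])
    refine le_antisymm (lev_le h1 h7 h3)
      (lev_le h4 (by omega) h6)
  refine ⟨hM, hD.base, fun e he => ?_, fun i h1 h2 => hD.span_eq i h1 (by simp only at h2; omega)⟩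
  have := hD.subset he
  rw [mem_edgesOf_iff] at this ⊢
  simpa only [hlev] using this

/-- Levels outside the first set drop uniformly by one, and an edge of the first set has no
competitor, so no comparison changes. -/
theorem IsWeakCertificate.dropFirst {G : ColorfulGraph U E n} (hG : G.IsRanked) {F : Finset E}
    {D : EdgeChain E} (hD : G.IsWeakCertificate F D) {p : ℕ} (hp : D.len = p + 1) (hp1 : 1 ≤ p)
    (hfirst : ∀ e ∈ D.set 1, ∀ f, G.color f = G.color e → f = e) :
    G.IsWeakCertificate F ⟨p, fun i => D.set (i + 1)⟩ := by
  have hM : (⟨p, fun i => D.set (i + 1)⟩ : EdgeChain E).IsMultichain :=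
    ⟨hp1, fun i h1 h2 => hD.mono (i + 1) (by omega) (by simp only at h2; omega), by
      simp only [← hp, hD.last]⟩
  have hlev : ∀ e, e ∉ D.set 1 → lev ⟨p, fun i => D.set (i + 1)⟩ e + 1 = lev D e := by
    intro e he
    obtain ⟨h1, h2, h3⟩ := hD.lev_spec e
    obtain ⟨h4, h5, h6⟩ := hM.lev_spec e
    simp only at h5 h6
    have h7 : lev D e ≠ 1 := fun h => he (h ▸ h3)
    have h8 : lev ⟨p, fun i => D.set (i + 1)⟩ e ≤ lev D e - 1 := by
      refine lev_le (by omega) (by simp only; omega) ?_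
      simp only
      rwa [Nat.sub_add_cancel h1]
    have h9 := lev_le (C := D) (by omega) (by omega) h6
    omega
  refine ⟨hM, hD.base, fun e he => ?_, fun i h1 h2 =>
    hD.span_eq (i + 1) (by omega) (by simp only at h2; omega)⟩
  have := hD.subset he
  rw [mem_edgesOf_iff] at this ⊢
  intro f hf
  by_cases hfe : f = e
  · subst hfe
    exact ⟨by omega, fun h => by omega, fun _ h => hG.asymm rfl h h⟩
  · have h1 := hlev e fun h => hfe (hfirst e h f hf)
    have h2 := hlev f fun h => hfe (hfirst f h e hf.symm).symm
    obtain ⟨h3, h4, h5⟩ := this f hf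
    exact ⟨by omega, fun h => h4 (by omega), fun h => h5 (by omega)⟩

/-- A shortest certificate consists of at most two sets. -/
theorem IsWeakCertificate.len_le_two {G : ColorfulGraph U E n} {b : Fin n → E}
    (hb : G.IsPadding b) {F : Finset E} {D : EdgeChain E} (hD : G.IsWeakCertificate F D)
    (hmin : ∀ D', G.IsWeakCertificate F D' → D.len ≤ D'.len) :
    D.len ≤ 2 ∧ (D.len = 2 → (D.set 1).Nonempty ∧ D.set 1 ≠ Finset.univ) := by
  rcases Nat.lt_or_ge D.len 2 with hlt | hge
  · exact ⟨by omega, by omega⟩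
  obtain ⟨p, hp⟩ : ∃ p, D.len = p + 1 := ⟨D.len - 1, by omega⟩
  have hlast : D.set p ≠ Finset.univ := fun h => by
    have := hmin _ (hD.dropLast hp (by omega) h)
    simp only at this
    omega
  obtain ⟨e, he, g, hge, hne⟩ : ∃ e ∈ D.set 1, ∃ g, G.color g = G.color e ∧ g ≠ e := by
    by_contra! h
    have := hmin _ (hD.dropFirst hb.ranked hp (by omega) h)
    simp only at this
    omega
  have hfirst : D.set 1 ≠ Finset.univ := fun h => hlast
    (Finset.univ_subset_iff.1 (h ▸ hD.toIsMultichain.subset le_rfl (by omega) (by omega)))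
  -- If `F ∩ D_1` had only padding edges, `e` could not belong to it, since `g` beats the padding
  -- edge at the lowest level. But then `e` together with isolated edges is a forest, so `e` is not
  -- spanned by `F ∩ D_1`.
  obtain ⟨f, hfF, hf1, hfb⟩ : ∃ f ∈ F, f ∈ D.set 1 ∧ f ≠ b (G.color f) := by
    by_contra! h
    have heT : e ∉ F ∩ D.set 1 := by
      intro heT
      rw [Finset.mem_inter] at heT
      have heb := h e heT.1 heT.2
      have hpref : G.pref g e := by
        rw [heb, ← hge]
        exact hb.worst (by rwa [hge, ← heb])
      obtain ⟨h1, h2, h3⟩ := G.mem_edgesOf_iff.1 (hD.subset heT.1) g hge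
      have h4 := lev_le le_rfl (by omega) heT.2
      have h5 := (hD.lev_spec g).1
      have h6 := (hD.lev_spec e).1
      rcases Nat.lt_or_ge (lev D e) (lev D g) with h7 | h7
      · exact hb.ranked.asymm hge hpref (h2 (by omega))
      · exact h3 (by omega) hpref
    have hcard := hb.card_inter_lt hD.base (hD.span_eq 1 le_rfl (by omega)) hfirst
    have hins : G.Indep (insert e (F ∩ D.set 1)) := by
      refine ⟨?_, by rw [Finset.card_insert_of_notMem heT]; omega⟩
      rw [Finset.insert_eq, Finset.union_comm]
      exact hb.isForest_union (hb.loopless e) fun f hf =>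
        ⟨_, h f (Finset.mem_inter.1 hf).1 (Finset.mem_inter.1 hf).2⟩
    exact hins.notMem_span heT (by rwa [hD.span_eq 1 le_rfl (by omega)])
  refine ⟨?_, fun _ => ⟨⟨e, he⟩, hfirst⟩⟩
  have hbF : b (G.color f) ∉ F := fun h => hfb
    (hD.base.1.2 f hfF _ h (hb.color_eq _).symm)
  -- An isolated edge outside `F` is spanned by no fewer than `n` edges of `F`, so this one has
  -- level `p + 1`; membership of `f` in E(𝒟) at level 1 then gives `p + 1 ≤ 2`.
  have hbp : b (G.color f) ∉ D.set p := by
    rw [← hD.span_eq p (by omega) (by omega)]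
    exact hb.notMem_span (hD.base.indep.mono Finset.inter_subset_left)
      (hb.card_inter_lt hD.base (hD.span_eq p (by omega) (by omega)) hlast)
      fun h => hbF (Finset.mem_inter.1 h).1
  rw [hD.toIsMultichain.mem_iff (by omega) (by omega)] at hbp
  have h1 := (G.mem_edgesOf_iff.1 (hD.subset hfF) _ (hb.color_eq (G.color f))).1
  have h2 := lev_le le_rfl (by omega) hf1
  omega

theorem Returns.isWeakCertificate {G : ColorfulGraph U E n} {b : Fin n → E} (hb : G.IsPadding b)
    {F : Finset E} {C : EdgeChain E} (h : G.Returns F C) : G.IsWeakCertificate F C := by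
  obtain ⟨hreach, -, hF, hrank⟩ := h
  obtain ⟨hC, hcl⟩ := hreach.isMultichain
  refine ⟨hC, ⟨⟨hF.1.1.1.1, hF.1.1.2⟩, ?_⟩, hF.1.2, fun i h1 h2 => ?_⟩
  · have := hrank _ hC.one_le_len le_rfl
    rwa [hC.last, Finset.inter_univ, hb.rank_univ] at this
  · apply subset_antisymm
    · exact (G.span_mono Finset.inter_subset_right).trans_eq (hcl i h1 h2)
    · exact (hF.1.1.1.mono Finset.inter_subset_left).subset_span_of_rank_le
        Finset.inter_subset_right (hrank i h1 h2).ge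

theorem Returns.isDualCertificate {G : ColorfulGraph U E n} {b : Fin n → E} (hb : G.IsPadding b)
    {F : Finset E} {C : EdgeChain E} (h : G.Returns F C) :
    G.IsDualCertificate F C ∧ C.len ≤ 2 := by
  have hC := h.isWeakCertificate hb
  obtain ⟨h1, h2⟩ := hC.len_le_two hb fun D hD => (h.1.le_certificate hb.ranked hD).1
  refine ⟨⟨hC.base, hC.one_le_len, ?_, fun i h3 h4 => ?_, hC.last, hC.subset, hC.span_eq⟩, h1⟩
  · have := hC.one_le_len
    rcases Nat.lt_or_ge C.len 2 with hlt | hge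
    · rw [show 1 = C.len by omega, hC.last]
      -- The loop condition `1 ≤ p ≤ n` supplies a colour, so `E` is nonempty.
      exact ⟨b ⟨0, by have := h.2.1; omega⟩, Finset.mem_univ _⟩
    · exact (h2 (by omega)).1
  · obtain rfl : i = 1 := by omega
    rw [show 1 + 1 = C.len by omega, hC.last]
    exact Finset.ssubset_univ_iff.2 (h2 (by omega)).2

end

end ColorfulGraph

namespace Matroid

open scoped Classical

variable {α : Type*}

/-! ### Symmetric exchange, Rado's theorem and maximum-weight bases -/

/-- The element `f` is taken on the fundamental circuit of `e` in `B₂`, outside the closure of `B₁ -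
e`; it exists because otherwise that closure would contain `e`. -/
theorem IsBase.symm_exchange {M : Matroid α} {B₁ B₂ : Set α} (h₁ : M.IsBase B₁)
    (h₂ : M.IsBase B₂) {e : α} (he₁ : e ∈ B₁) (he₂ : e ∉ B₂) :
    ∃ f ∈ B₂, f ∉ B₁ ∧ M.IsBase (insert f (B₁ \ {e})) ∧ M.IsBase (insert e (B₂ \ {f})) := by
  have heE : e ∈ M.E := h₁.subset_ground he₁
  have hcl : e ∈ M.closure B₂ := by rwa [h₂.closure_eq]
  have hcirc := h₂.indep.fundCircuit_isCircuit hcl he₂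
  obtain ⟨f, ⟨hfC, hfe⟩, hf⟩ : ∃ f ∈ M.fundCircuit e B₂ \ {e}, f ∉ M.closure (B₁ \ {e}) := by
    by_contra! h
    exact h₁.indep.notMem_closure_sdiff_of_mem he₁ (closure_subset_closure_of_subset_closure h
      (hcirc.mem_closure_sdiff_singleton_of_mem (M.mem_fundCircuit e B₂)))
  have hfe' : f ≠ e := hfe
  have hf₂ : f ∈ B₂ := (M.fundCircuit_subset_insert e B₂ hfC).resolve_left hfe'
  have hfE : f ∈ M.E := h₂.subset_ground hf₂
  refine ⟨f, hf₂, fun hf₁ => hf ?_, h₁.exchange_base_of_notMem_closure he₁ hf hfE, ?_⟩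
  · exact M.mem_closure_of_mem ⟨hf₁, hfe⟩ (Set.sdiff_subset.trans h₁.subset_ground)
  · refine h₂.exchange_isBase_of_indep he₂ ?_
    rw [Set.insert_sdiff_singleton_comm hfe'.symm]
    exact (h₂.indep.mem_fundCircuit_iff hcl he₂).1 hfC

/-- `B` is a base of maximum weight. -/
def IsMaxBase (M : Matroid α) (v : α → ℤ) (B : Finset α) : Prop :=
  M.IsBase (B : Set α) ∧ ∀ B' : Finset α, M.IsBase (B' : Set α) → ∑ e ∈ B', v e ≤ ∑ e ∈ B, v e

theorem sum_insert_erase {v : α → ℤ} {B : Finset α} {e f : α} (he : e ∉ B) (hf : f ∈ B) :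
    ∑ x ∈ insert e (B.erase f), v x = ∑ x ∈ B, v x - v f + v e := by
  rw [Finset.sum_insert (by simp [he]), ← Finset.sum_erase_add B v hf]
  ring

theorem IsMaxBase.le_of_exchange {M : Matroid α} {v : α → ℤ} {B : Finset α}
    (h : M.IsMaxBase v B) {e f : α} (he : e ∉ B) (hf : f ∈ B)
    (hef : M.IsBase (insert e (B.erase f) : Finset α)) : v e ≤ v f := by
  have := h.2 _ hef
  rw [sum_insert_erase he hf] at this
  linarith

theorem exists_finset_maximizing [Finite α] (P : Finset α → Prop)
    (hP : ∃ B : Finset α, P B) (g : Finset α → ℤ) :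
    ∃ B, P B ∧ ∀ B', P B' → g B' ≤ g B := by
  have := Fintype.ofFinite α
  obtain ⟨B₀, hB₀⟩ := hP
  obtain ⟨B, hB, hmax⟩ := Finset.exists_max_image (Finset.univ.filter P) g ⟨B₀, by simp [hB₀]⟩
  simp only [Finset.mem_filter, Finset.mem_univ, true_and] at hB hmax
  exact ⟨B, hB, hmax⟩

/-- As long as some `A i` has two elements, one of them can be deleted without violating Rado's
condition; singletons then give the transversal. -/
theorem exists_transversal_of_submodular {ι : Type*} (r : Finset α → ℕ) (hr0 : r ∅ = 0)
    (hmono : ∀ X Y, X ⊆ Y → r X ≤ r Y) (hsub : ∀ X Y, r (X ∩ Y) + r (X ∪ Y) ≤ r X + r Y)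
    [Fintype ι] (A : ι → Finset α) (hA : ∀ T : Finset ι, T.card ≤ r (T.biUnion A)) :
    ∃ x : ι → α, (∀ i, x i ∈ A i) ∧ ∀ T : Finset ι, T.card ≤ r (T.image x) := by
  by_cases hone : ∀ i, (A i).card ≤ 1
  · have hex : ∀ i, ∃ x, A i = {x} := by
      intro i
      rw [← Finset.card_eq_one]
      refine le_antisymm (hone i) (Finset.card_pos.2 ?_)
      rw [Finset.nonempty_iff_ne_empty]
      intro h
      have := hA {i}
      simp [h, hr0] at this
    choose x hx using hex
    refine ⟨x, fun i => by simp [hx], fun T => ?_⟩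
    have : T.biUnion A = T.image x := by
      ext y
      simp [hx, eq_comm]
    exact this ▸ hA T
  · push Not at hone
    obtain ⟨i, hi⟩ := hone
    obtain ⟨y, hy, z, hz, hyz⟩ := Finset.one_lt_card.1 hi
    have hstep : ∀ u ∈ A i, (∃ x : ι → α, (∀ i, x i ∈ A i) ∧
        ∀ T : Finset ι, T.card ≤ r (T.image x)) ∨
        ∃ T : Finset ι, r (T.biUnion (Function.update A i ((A i).erase u))) < T.card := by
      intro u hu
      by_cases hall : ∀ T : Finset ι,
          T.card ≤ r (T.biUnion (Function.update A i ((A i).erase u)))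
      · have hdecr : ∑ j, (Function.update A i ((A i).erase u) j).card < ∑ j, (A j).card := by
          refine Finset.sum_lt_sum (fun j _ => ?_) ⟨i, Finset.mem_univ _, ?_⟩
          · rcases eq_or_ne j i with rfl | hj
            · rw [Function.update_self]
              exact Finset.card_le_card (Finset.erase_subset _ _)
            · rw [Function.update_of_ne hj]
          · rw [Function.update_self]
            exact Finset.card_erase_lt_of_mem hu
        obtain ⟨x, hx, hxT⟩ := exists_transversal_of_submodular r hr0 hmono hsub _ hall
        refine Or.inl ⟨x, fun j => ?_, hxT⟩
        have := hx j
        rcases eq_or_ne j i with rfl | hj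
        · rw [Function.update_self] at this
          exact Finset.mem_of_mem_erase this
        · rwa [Function.update_of_ne hj] at this
      · push Not at hall
        exact Or.inr hall
    rcases hstep y hy with h | ⟨T₁, h₁⟩
    · exact h
    rcases hstep z hz with h | ⟨T₂, h₂⟩
    · exact h
    exfalso
    have hupd : ∀ (T : Finset ι) (X : Finset α), i ∉ T → T.biUnion (Function.update A i X) =
        T.biUnion A := fun T X hT => Finset.biUnion_congr rfl fun j hj => by
      rw [Function.update_of_ne (ne_of_mem_of_not_mem hj hT)]
    have hi₁ : i ∈ T₁ := by
      by_contra h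
      rw [hupd T₁ _ h] at h₁
      exact absurd (hA T₁) (by omega)
    have hi₂ : i ∈ T₂ := by
      by_contra h
      rw [hupd T₂ _ h] at h₂
      exact absurd (hA T₂) (by omega)
    set X := T₁.biUnion (Function.update A i ((A i).erase y)) with hX
    set Y := T₂.biUnion (Function.update A i ((A i).erase z)) with hY
    have hXsub : ∀ j ∈ T₁, j ≠ i → A j ⊆ X := fun j hj hji a ha =>
      Finset.mem_biUnion.2 ⟨j, hj, by rwa [Function.update_of_ne hji]⟩
    have hYsub : ∀ j ∈ T₂, j ≠ i → A j ⊆ Y := fun j hj hji a ha =>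
      Finset.mem_biUnion.2 ⟨j, hj, by rwa [Function.update_of_ne hji]⟩
    have hunion : (T₁ ∪ T₂).biUnion A ⊆ X ∪ Y := by
      intro a ha
      obtain ⟨j, hj, haj⟩ := Finset.mem_biUnion.1 ha
      rw [Finset.mem_union]
      rcases eq_or_ne j i with rfl | hji
      · by_cases hay : a = y
        · exact Or.inr (Finset.mem_biUnion.2 ⟨j, hi₂, by
            rw [Function.update_self, Finset.mem_erase]
            exact ⟨hay ▸ hyz, haj⟩⟩)
        · exact Or.inl (Finset.mem_biUnion.2 ⟨j, hi₁, by
            rw [Function.update_self, Finset.mem_erase]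
            exact ⟨hay, haj⟩⟩)
      · exact (Finset.mem_union.1 hj).imp (fun h => hXsub j h hji haj) fun h => hYsub j h hji haj
    have hinter : ((T₁ ∩ T₂).erase i).biUnion A ⊆ X ∩ Y := by
      intro a ha
      obtain ⟨j, hj, haj⟩ := Finset.mem_biUnion.1 ha
      rw [Finset.mem_erase, Finset.mem_inter] at hj
      exact Finset.mem_inter.2 ⟨hXsub j hj.2.1 hj.1 haj, hYsub j hj.2.2 hj.1 haj⟩
    -- Submodularity makes the two violations incompatible: |T₁ ∪ T₂| + |T₁ ∩ T₂| - 1 ≤ r X + r Y ≤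
    -- |T₁| + |T₂| - 2.
    have e1 := (hA _).trans (hmono _ _ hunion)
    have e2 := (hA _).trans (hmono _ _ hinter)
    rw [Finset.card_erase_of_mem (Finset.mem_inter.2 ⟨hi₁, hi₂⟩)] at e2
    have e3 := hsub X Y
    have e4 := Finset.card_union_add_card_inter T₁ T₂
    omega
termination_by ∑ i, (A i).card

/-- Rado's theorem: a family of sets has an independent transversal if the union of any `k` of its
members has rank at least `k`. -/
theorem exists_indep_transversal (M : Matroid α) {ι : Type*} [Fintype ι] (A : ι → Finset α)
    (hA : ∀ T : Finset ι, (T.card : ℕ∞) ≤ M.eRk (T.biUnion A : Finset α)) :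
    ∃ x : ι → α, (∀ i, x i ∈ A i) ∧ Function.Injective x ∧
      M.Indep (Finset.univ.image x : Finset α) := by
  have hex : ∀ X : Finset α, ∃ k : ℕ, (k : ℕ∞) = M.eRk (X : Set α) := fun X =>
    ENat.ne_top_iff_exists.1 ((M.eRk_le_encard _).trans_lt
      (Set.encard_lt_top_iff.2 X.finite_toSet)).ne
  choose r hr using hex
  have hle : ∀ X, r X ≤ X.card := fun X => by
    have := M.eRk_le_encard (X : Set α)
    rw [Set.encard_coe_eq_coe_finsetCard, ← hr] at this
    exact_mod_cast this
  obtain ⟨x, hx, hT⟩ := exists_transversal_of_submodular r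
    (by simpa using hle ∅) (fun X Y h => by
      have := M.eRk_mono (show (X : Set α) ⊆ Y by exact_mod_cast h)
      rw [← hr, ← hr] at this
      exact_mod_cast this) (fun X Y => by
      have := M.eRk_inter_add_eRk_union_le (X : Set α) Y
      rw [← Finset.coe_inter, ← Finset.coe_union, ← hr, ← hr, ← hr, ← hr] at this
      exact_mod_cast this) A (fun T => by
      have := hA T
      rw [← hr] at this
      exact_mod_cast this)
  have hcard := hT Finset.univ
  have hle' := hle (Finset.univ.image x)
  have himg : (Finset.univ.image x).card ≤ (Finset.univ : Finset ι).card := Finset.card_image_le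
  refine ⟨x, hx, ?_, ?_⟩
  · have : Set.InjOn x (Finset.univ : Finset ι) := Finset.card_image_iff.1 (by omega)
    simpa using this
  · rw [Matroid.indep_iff_eRk_eq_encard_of_finite (Finset.finite_toSet _),
      Set.encard_coe_eq_coe_finsetCard, ← hr]
    exact_mod_cast (by omega : r (Finset.univ.image x) = _)

section Fintype

variable [Fintype α]

theorem exists_isMaxBase (M : Matroid α) (v : α → ℤ) : ∃ B, M.IsMaxBase v B := by
  refine exists_finset_maximizing (fun B => M.IsBase (B : Set α)) ?_ fun B => ∑ e ∈ B, v e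
  obtain ⟨B, hB⟩ := M.exists_isBase
  exact ⟨B.toFinset, by simpa using hB⟩

/-- A base that no single exchange improves has maximum weight. -/
theorem isMaxBase_of_forall_exchange {M : Matroid α} {v : α → ℤ} {B : Finset α}
    (hB : M.IsBase (B : Set α)) (h : ∀ e ∉ B, ∀ f ∈ B,
      M.IsBase (insert e (B.erase f) : Finset α) → v e ≤ v f) : M.IsMaxBase v B := by
  -- A maximum-weight base closest to `B`: a symmetric exchange toward `B` would keep its weight
  -- maximum and increase the overlap.
  obtain ⟨A, hA, hmax⟩ := exists_finset_maximizing (fun A => M.IsMaxBase v A)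
    (M.exists_isMaxBase v) fun A => ((A ∩ B).card : ℤ)
  suffices hBA : B ⊆ A by
    have := hB.eq_of_subset_isBase hA.1 (by exact_mod_cast hBA)
    rwa [Finset.coe_inj.1 this]
  by_contra hBA
  obtain ⟨f, hfB, hfA⟩ := Finset.not_subset.1 hBA
  obtain ⟨e, heA, heB, h1, h2⟩ := hB.symm_exchange hA.1 (e := f) (by exact_mod_cast hfB)
    (by exact_mod_cast hfA)
  rw [Finset.mem_coe] at heA heB
  have hle := h e heB f hfB (by push_cast; exact h1)
  have hA' : M.IsMaxBase v (insert f (A.erase e)) := by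
    refine ⟨by push_cast; exact h2, fun B' hB' => (hA.2 B' hB').trans ?_⟩
    rw [sum_insert_erase hfA heA]
    linarith
  have := hmax _ hA'
  rw [Finset.insert_inter_of_mem hfB, Finset.card_insert_of_notMem (by simp [hfA]),
    Finset.erase_inter, Finset.erase_eq_of_notMem (by simp [heB])] at this
  push_cast at this
  linarith

/-- The maximum-weight bases are the bases of a matroid. -/
noncomputable def maxBaseMatroid (M : Matroid α) (v : α → ℤ) : Matroid α :=
  Matroid.ofIsBaseOfFinite (E := Set.univ) Set.finite_univ
    (fun S => ∃ B : Finset α, (B : Set α) = S ∧ M.IsMaxBase v B)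
    (by
      obtain ⟨B, hB⟩ := M.exists_isMaxBase v
      exact ⟨B, B, rfl, hB⟩)
    (by
      rintro _ _ ⟨B₁, rfl, h₁⟩ ⟨B₂, rfl, h₂⟩ e ⟨he₁, he₂⟩
      obtain ⟨f, hf₂, hf₁, h3, h4⟩ := h₁.1.symm_exchange h₂.1 he₁ he₂
      rw [Finset.mem_coe] at he₁ he₂ hf₁ hf₂
      have h3' : M.IsBase (insert f (B₁.erase e) : Finset α) := by push_cast; exact h3
      -- Optimality of `B₂` shows that the exchange in `B₁` loses no weight.
      have h5 := h₂.le_of_exchange he₂ hf₂ (by push_cast; exact h4)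
      refine ⟨f, ⟨by exact_mod_cast hf₂, by exact_mod_cast hf₁⟩, insert f (B₁.erase e),
        by push_cast; rfl, h3', fun B' hB' => (h₁.2 B' hB').trans ?_⟩
      rw [sum_insert_erase hf₁ he₁]
      linarith)
    (fun _ _ => Set.subset_univ _)

theorem maxBaseMatroid_isBase {M : Matroid α} {v : α → ℤ} {B : Finset α} :
    (M.maxBaseMatroid v).IsBase (B : Set α) ↔ M.IsMaxBase v B := by
  change (∃ B' : Finset α, (B' : Set α) = B ∧ M.IsMaxBase v B') ↔ _
  exact ⟨fun ⟨B', h, h'⟩ => Finset.coe_inj.1 h ▸ h', fun h => ⟨B, rfl, h⟩⟩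

/-! ### Weight splitting -/

/-- Weight splitting for the intersection of a matroid with a partition matroid: up to a potential
on the colour classes, some colourful base is a maximum-weight base of the matroid. -/
theorem exists_weight_splitting (M : Matroid α) {n : ℕ} (c : α → Fin n) (w : α → ℤ)
    (x₀ : Fin n → α) (hx₀ : ∀ i, c (x₀ i) = i)
    (hbase : M.IsBase (Finset.univ.image x₀ : Finset α)) :
    ∃ (a : Fin n → ℤ) (x : Fin n → α), (∀ i, c (x i) = i) ∧
      M.IsMaxBase (fun e => w e - a (c e)) (Finset.univ.image x) := by
  have hinj : ∀ x : Fin n → α, (∀ i, c (x i) = i) → Function.Injective x :=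
    fun x hx i j h => by rw [← hx i, h, hx]
  have hcardx₀ : (Finset.univ.image x₀).card = n := by
    rw [Finset.card_image_of_injective _ (hinj x₀ hx₀), Finset.card_univ, Fintype.card_fin]
  -- Values of the dual objective: total potential plus maximum modified weight. They are integers
  -- bounded below by the weight of the base `x₀`, so a minimum exists.
  let P : ℤ → Prop := fun z => ∃ (a : Fin n → ℤ) (B : Finset α),
    M.IsMaxBase (fun e => w e - a (c e)) B ∧ z = ∑ i, a i + ∑ e ∈ B, (w e - a (c e))
  obtain ⟨z, ⟨a, B, hB, rfl⟩, hmin⟩ : ∃ z, P z ∧ ∀ z', P z' → z ≤ z' := by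
    refine Int.exists_least_of_bdd ⟨∑ i, w (x₀ i), ?_⟩ ?_
    · rintro _ ⟨a, B, hB, rfl⟩
      have := hB.2 _ hbase
      rw [Finset.sum_image fun i _ j _ h => hinj x₀ hx₀ h] at this
      simp only [hx₀, Finset.sum_sub_distrib] at this ⊢
      linarith
    · obtain ⟨B, hB⟩ := M.exists_isMaxBase fun e => w e - (0 : Fin n → ℤ) (c e)
      exact ⟨_, 0, B, hB, rfl⟩
  set v : α → ℤ := fun e => w e - a (c e) with hv
  refine ⟨a, ?_⟩
  have hMB := maxBaseMatroid_isBase.2 hB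
  have hBcard : B.card = n := by
    have := hB.1.encard_eq_encard_of_isBase hbase
    rw [Set.encard_coe_eq_coe_finsetCard, Set.encard_coe_eq_coe_finsetCard, hcardx₀] at this
    exact_mod_cast this
  by_cases hall : ∀ T : Finset (Fin n), (T.card : ℕ∞) ≤
      (M.maxBaseMatroid v).eRk (T.biUnion fun i => Finset.univ.filter fun e => c e = i : Finset α)
  · obtain ⟨x, hx, hxinj, hxind⟩ := (M.maxBaseMatroid v).exists_indep_transversal _ hall
    refine ⟨x, fun i => by simpa using hx i, maxBaseMatroid_isBase.1 ?_⟩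
    refine hxind.isBase_of_eRk_ge (Finset.finite_toSet _) ?_
    rw [hxind.eRk_eq_encard, ← hMB.encard_eq_eRank, Set.encard_coe_eq_coe_finsetCard,
      Set.encard_coe_eq_coe_finsetCard, hBcard, Finset.card_image_of_injective _ hxinj]
    simp
  · exfalso
    push Not at hall
    obtain ⟨T, hT⟩ := hall
    set X : Finset α := T.biUnion fun i => Finset.univ.filter fun e => c e = i with hX
    have hmemX : ∀ e, e ∈ X ↔ c e ∈ T := fun e => by simp [hX]
    -- Without a colourful maximum-weight base, Rado's condition fails on `T`. Lowering the
    -- potential by one on `T` rewards the edges of `X`; the optimal base richest in `X` stays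
    -- optimal, and the objective changes by |B' ∩ X| - |T| < 0.
    obtain ⟨B', hB', hmax⟩ := exists_finset_maximizing (fun A => M.IsMaxBase v A)
      ⟨B, hB⟩ fun A => ((A ∩ X).card : ℤ)
    have hlt : (B' ∩ X).card < T.card := by
      have h1 := ((maxBaseMatroid_isBase.2 hB').indep.subset
        (show ((B' ∩ X : Finset α) : Set α) ⊆ B' by
          exact_mod_cast Finset.inter_subset_left)).encard_le_eRk_of_subset
        (show ((B' ∩ X : Finset α) : Set α) ⊆ X by exact_mod_cast Finset.inter_subset_right)
      rw [Set.encard_coe_eq_coe_finsetCard] at h1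
      exact_mod_cast h1.trans_lt hT
    let a' : Fin n → ℤ := fun i => a i - if i ∈ T then 1 else 0
    have hv' : ∀ e, w e - a' (c e) = v e + if e ∈ X then 1 else 0 := fun e => by
      simp only [a', hv, hmemX]
      ring
    have hB'' : M.IsMaxBase (fun e => w e - a' (c e)) B' := by
      refine isMaxBase_of_forall_exchange hB'.1 fun e he f hf hef => ?_
      have h1 := hB'.le_of_exchange he hf hef
      simp only [hv']
      -- A strict loss is at least 1 by integrality and absorbs the reward; with no loss, the
      -- exchanged base is again optimal and cannot contain more of `X`.
      rcases h1.lt_or_eq with h2 | h2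
      · split_ifs <;> omega
      · have h3 : M.IsMaxBase v (insert e (B'.erase f)) := by
          refine ⟨hef, fun A hA => (hB'.2 A hA).trans ?_⟩
          rw [sum_insert_erase he hf]
          linarith
        have h4 := hmax _ h3
        have h5 := ColorfulGraph.card_insert_erase_inter (X := X) he hf
        split_ifs at h5 ⊢ <;> omega
    have h1 := hmin _ ⟨a', B', hB'', rfl⟩
    have h2 : B.sum v = ∑ e ∈ B', v e := le_antisymm (hB'.2 B hB.1) (hB.2 B' hB'.1)
    have h3 : ∑ i, a' i = ∑ i, a i - T.card := by simp [a', Finset.sum_sub_distrib]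
    have h4 : ∑ e ∈ B', (w e - a' (c e)) = ∑ e ∈ B', v e + (B' ∩ X).card := by
      simp only [hv', Finset.sum_add_distrib, Finset.sum_boole]
      rw [Finset.filter_mem_eq_inter]
    omega

end Fintype

end Matroid

namespace Matroid

open scoped Classical

/-- The other elements of the fundamental circuit of `e` weigh at least `v e`, since exchanging any
of them for `e` gives a base. Hence superlevel sets of `v` are spanned by their part in `B`. -/
theorem IsMaxBase.mem_closure {α : Type*} {M : Matroid α} {v : α → ℤ} {B : Finset α}
    (h : M.IsMaxBase v B) {e : α} (he : e ∈ M.E) :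
    e ∈ M.closure (B.filter fun f => v e ≤ v f : Finset α) := by
  by_cases heB : e ∈ B
  · exact M.mem_closure_of_mem' (by simp [heB]) he
  have heB' : e ∉ (B : Set α) := by exact_mod_cast heB
  have hcl : e ∈ M.closure (B : Set α) := by rwa [h.1.closure_eq]
  have hcirc := h.1.indep.fundCircuit_isCircuit hcl heB'
  refine M.closure_subset_closure ?_ (hcirc.mem_closure_sdiff_singleton_of_mem
    (M.mem_fundCircuit e B))
  rintro f ⟨hfC, hfe⟩
  have hfe' : f ≠ e := hfe
  have hfB : f ∈ B := by exact_mod_cast (M.fundCircuit_subset_insert e B hfC).resolve_left hfe'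
  rw [Finset.mem_coe, Finset.mem_filter]
  refine ⟨hfB, h.le_of_exchange heB hfB ?_⟩
  push_cast
  refine h.1.exchange_isBase_of_indep heB' ?_
  rw [Set.insert_sdiff_singleton_comm hfe'.symm]
  exact (h.1.indep.mem_fundCircuit_iff hcl heB').1 hfC

end Matroid

namespace ColorfulGraph

noncomputable section

open scoped Classical

variable {U E : Type*} {n : ℕ}

/-! ### Popular colourful bases and their certificates -/

/-- A colourful base that no colourful base beats. -/
def IsPopularBase (G : ColorfulGraph U E n) (F : Finset E) : Prop :=
  G.IsColorfulBase F ∧ ∀ B, G.IsColorfulBase B → G.phi B F ≤ G.phi F B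

/-- The vote of an agent for `e` against `f`. -/
def vote (G : ColorfulGraph U E n) (e f : E) : ℤ :=
  (if G.pref e f then 1 else 0) - if G.pref f e then 1 else 0

theorem IsColorfulBase.exists_mem_color_eq {G : ColorfulGraph U E n} {F : Finset E}
    (hF : G.IsColorfulBase F) (i : Fin n) : ∃ e ∈ F, G.color e = i := by
  have himg : F.image G.color = Finset.univ := by
    rw [← Finset.card_eq_iff_eq_univ, Finset.card_image_of_injOn
      (fun e he f hf h => hF.1.2 e he f hf h), hF.2, Fintype.card_fin]
  exact Finset.mem_image.1 (himg ▸ Finset.mem_univ i)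

theorem IsColorfulBase.exists_eq_image {G : ColorfulGraph U E n} {F : Finset E}
    (hF : G.IsColorfulBase F) :
    ∃ x : Fin n → E, (∀ i, G.color (x i) = i) ∧ F = Finset.univ.image x := by
  choose x hxF hx using hF.exists_mem_color_eq
  refine ⟨x, hx, subset_antisymm (fun e he => ?_) fun e he => ?_⟩
  · exact Finset.mem_image.2 ⟨G.color e, Finset.mem_univ _, hF.1.2 _ (hxF _) _ he (hx _)⟩
  · obtain ⟨i, -, rfl⟩ := Finset.mem_image.1 he
    exact hxF i

theorem injective_of_color {G : ColorfulGraph U E n} {x : Fin n → E}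
    (hx : ∀ i, G.color (x i) = i) : Function.Injective x :=
  fun i j h => by rw [← hx i, h, hx]

theorem isColorfulBase_image_iff (G : ColorfulGraph U E n) {x : Fin n → E}
    (hx : ∀ i, G.color (x i) = i) :
    G.IsColorfulBase (Finset.univ.image x) ↔ G.Indep (Finset.univ.image x) := by
  refine ⟨fun h => h.indep, fun h => ⟨⟨h.1, ?_⟩, ?_⟩⟩
  · intro e he f hf hef
    obtain ⟨i, -, rfl⟩ := Finset.mem_image.1 he
    obtain ⟨j, -, rfl⟩ := Finset.mem_image.1 hf
    rw [hx, hx] at hef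
    rw [hef]
  · rw [Finset.card_image_of_injective _ (injective_of_color hx), Finset.card_univ,
      Fintype.card_fin]

theorem prefers_image_iff (G : ColorfulGraph U E n) {x y : Fin n → E}
    (hx : ∀ i, G.color (x i) = i) (hy : ∀ i, G.color (y i) = i) (i : Fin n) :
    G.Prefers i (Finset.univ.image x) (Finset.univ.image y) ↔ G.pref (x i) (y i) := by
  constructor
  · rintro (⟨-, h⟩ | ⟨e, he, f, hf, rfl, hfe, h⟩)
    · exact absurd (hy i) (h _ (Finset.mem_image_of_mem _ (Finset.mem_univ i)))
    · obtain ⟨j, -, rfl⟩ := Finset.mem_image.1 he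
      obtain ⟨k, -, rfl⟩ := Finset.mem_image.1 hf
      rw [hx, hy] at hfe
      subst hfe
      rwa [hx]
  · intro h
    exact Or.inr ⟨x i, Finset.mem_image_of_mem _ (Finset.mem_univ i), y i,
      Finset.mem_image_of_mem _ (Finset.mem_univ i), hx i, hy i, h⟩

theorem phi_sub_phi (G : ColorfulGraph U E n) {x y : Fin n → E}
    (hx : ∀ i, G.color (x i) = i) (hy : ∀ i, G.color (y i) = i) :
    (G.phi (Finset.univ.image x) (Finset.univ.image y) : ℤ) -
      G.phi (Finset.univ.image y) (Finset.univ.image x) = ∑ i, G.vote (x i) (y i) := by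
  simp only [phi, G.prefers_image_iff hx hy, G.prefers_image_iff hy hx, vote,
    Finset.sum_sub_distrib, Finset.sum_boole]

theorem vote_self (G : ColorfulGraph U E n) (e : E) : G.vote e e = 0 := by
  simp [vote]

theorem vote_comm (G : ColorfulGraph U E n) (e f : E) : G.vote e f = -G.vote f e := by
  simp [vote]

theorem neg_one_le_vote (G : ColorfulGraph U E n) (e f : E) : -1 ≤ G.vote e f := by
  simp only [vote]
  split_ifs <;> omega

theorem vote_le_one (G : ColorfulGraph U E n) (e f : E) : G.vote e f ≤ 1 := by
  simp only [vote]
  split_ifs <;> omega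

theorem pref_of_vote_neg {G : ColorfulGraph U E n} {e f : E} (h : G.vote e f < 0) :
    G.pref f e := by
  by_contra hfe
  simp only [vote, hfe, if_false] at h
  split_ifs at h <;> omega

theorem IsRanked.not_pref_of_vote_nonpos {G : ColorfulGraph U E n} (hG : G.IsRanked) {e f : E}
    (hef : G.color e = G.color f) (h : G.vote e f ≤ 0) : ¬ G.pref e f := by
  intro h1
  simp only [vote, h1, hG.asymm hef h1, if_true, if_false] at h
  omega

theorem IsRanked.vote_eq_neg_one {G : ColorfulGraph U E n} (hG : G.IsRanked) {e f : E}
    (hef : G.color e = G.color f) (h : G.pref f e) : G.vote e f = -1 := by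
  simp [vote, h, hG.asymm hef.symm h]

theorem vote_nonpos {G : ColorfulGraph U E n} {e f : E} (h : ¬ G.pref e f) : G.vote e f ≤ 0 := by
  simp only [vote, h, if_false]
  split_ifs <;> omega

variable [Fintype E]

/-- Double counting: `e` lies in `C_i` exactly for `lev e ≤ i ≤ p`. -/
theorem _root_.EdgeChain.IsMultichain.sum_lev {C : EdgeChain E} (hC : C.IsMultichain)
    (S : Finset E) :
    ∑ e ∈ S, ((C.len : ℤ) + 1 - lev C e) = ∑ i ∈ Finset.Icc 1 C.len, ((S ∩ C.set i).card : ℤ) := by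
  have h1 : ∀ e, ((C.len : ℤ) + 1 - lev C e) =
      ∑ i ∈ Finset.Icc 1 C.len, if e ∈ C.set i then (1 : ℤ) else 0 := by
    intro e
    have h2 : ((Finset.Icc 1 C.len).filter fun i => e ∈ C.set i) =
        Finset.Icc (lev C e) C.len := by
      ext i
      simp only [Finset.mem_filter, Finset.mem_Icc]
      have h1 := (hC.lev_spec e).1
      constructor
      · rintro ⟨⟨h2, h3⟩, h4⟩
        exact ⟨(hC.mem_iff h2 h3).1 h4, h3⟩
      · rintro ⟨h2, h3⟩
        exact ⟨⟨by omega, h3⟩, (hC.mem_iff (by omega) h3).2 h2⟩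
    have := (hC.lev_spec e).2.1
    rw [Finset.sum_boole, h2, Nat.card_Icc]
    omega
  simp only [h1]
  rw [Finset.sum_comm]
  refine Finset.sum_congr rfl fun i _ => ?_
  rw [Finset.sum_boole, Finset.filter_mem_eq_inter]

/-- Dual feasibility: levels act as prices that bound every vote against `F`. -/
theorem IsWeakCertificate.vote_le {G : ColorfulGraph U E n} (hG : G.IsRanked) {F : Finset E}
    {C : EdgeChain E} (hC : G.IsWeakCertificate F C) {e f : E} (hf : f ∈ F)
    (hef : G.color e = G.color f) : G.vote e f ≤ lev C f - lev C e := by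
  obtain ⟨h1, h2, h3⟩ := G.mem_edgesOf_iff.1 (hC.subset hf) e hef
  have h4 := G.vote_le_one e f
  rcases Nat.lt_trichotomy (lev C e) (lev C f) with h | h | h
  · omega
  · have := vote_nonpos (h3 h)
    omega
  · have := hG.vote_eq_neg_one hef (h2 (by omega))
    omega

/-- `F` attains the rank of every `C_i`, so it maximizes each intersection and thereby minimizes the
total level. -/
theorem IsWeakCertificate.sum_lev_le {G : ColorfulGraph U E n} {F : Finset E} {C : EdgeChain E}
    (hC : G.IsWeakCertificate F C) {B : Finset E} (hB : G.IsColorfulBase B) :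
    ∑ e ∈ F, (lev C e : ℤ) ≤ ∑ e ∈ B, (lev C e : ℤ) ∧
      (∑ e ∈ F, (lev C e : ℤ) = ∑ e ∈ B, (lev C e : ℤ) →
        ∀ i, 1 ≤ i → i ≤ C.len → (B ∩ C.set i).card = G.rank (C.set i)) := by
  have hle : ∀ i ∈ Finset.Icc 1 C.len,
      ((B ∩ C.set i).card : ℤ) ≤ ((F ∩ C.set i).card : ℤ) := fun i hi => by
    rw [Finset.mem_Icc] at hi
    rw [← hC.rank_eq hi.1 hi.2]
    exact_mod_cast G.le_rank (hB.indep.mono Finset.inter_subset_left) Finset.inter_subset_right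
  have hsum := Finset.sum_le_sum hle
  have hF := hC.toIsMultichain.sum_lev F
  have hB' := hC.toIsMultichain.sum_lev B
  rw [Finset.sum_sub_distrib, Finset.sum_const, hC.base.2] at hF
  rw [Finset.sum_sub_distrib, Finset.sum_const, hB.2] at hB'
  refine ⟨by linarith, fun h i h1 h2 => ?_⟩
  have := (Finset.sum_eq_sum_iff_of_le hle).1 (by linarith) i (Finset.mem_Icc.2 ⟨h1, h2⟩)
  rw [hC.rank_eq h1 h2]
  exact_mod_cast this

/-- Weak duality: a colourful base with a certificate is popular, and complementary slackness holds
for every colourful base it does not beat. -/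
theorem IsWeakCertificate.slackness {G : ColorfulGraph U E n} (hG : G.IsRanked) {F : Finset E}
    {C : EdgeChain E} (hC : G.IsWeakCertificate F C) {B : Finset E} (hB : G.IsColorfulBase B) :
    G.phi B F ≤ G.phi F B ∧ (G.phi F B ≤ G.phi B F →
      (∀ e ∈ B, ∀ f ∈ F, G.color e = G.color f → G.vote e f = lev C f - lev C e) ∧
      ∀ i, 1 ≤ i → i ≤ C.len → (B ∩ C.set i).card = G.rank (C.set i)) := by
  obtain ⟨hsum, hslack⟩ := hC.sum_lev_le hB
  obtain ⟨x, hx, hFx⟩ := hC.base.exists_eq_image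
  obtain ⟨y, hy, hBy⟩ := hB.exists_eq_image
  have hphi := G.phi_sub_phi hy hx
  rw [← hFx, ← hBy] at hphi
  have hle : ∀ i ∈ Finset.univ, G.vote (y i) (x i) ≤ lev C (x i) - lev C (y i) := fun i _ =>
    hC.vote_le hG (hFx ▸ Finset.mem_image_of_mem _ (Finset.mem_univ i)) ((hy i).trans (hx i).symm)
  have hle' := Finset.sum_le_sum hle
  have hF : ∑ e ∈ F, (lev C e : ℤ) = ∑ i, (lev C (x i) : ℤ) := by
    rw [hFx, Finset.sum_image fun i _ j _ h => injective_of_color hx h]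
  have hB' : ∑ e ∈ B, (lev C e : ℤ) = ∑ i, (lev C (y i) : ℤ) := by
    rw [hBy, Finset.sum_image fun i _ j _ h => injective_of_color hy h]
  rw [Finset.sum_sub_distrib] at hle'
  refine ⟨by omega, fun h => ⟨?_, hslack (by omega)⟩⟩
  have heq := (Finset.sum_eq_sum_iff_of_le hle).1 (by rw [Finset.sum_sub_distrib]; omega)
  rw [hFx, hBy]
  intro e he f hf hef
  obtain ⟨i, -, rfl⟩ := Finset.mem_image.1 he
  obtain ⟨j, -, rfl⟩ := Finset.mem_image.1 hf
  rw [hx, hy] at hef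
  rw [hef]
  exact heq j (Finset.mem_univ _)

theorem IsWeakCertificate.isPopularBase {G : ColorfulGraph U E n} (hG : G.IsRanked) {F : Finset E}
    {C : EdgeChain E} (hC : G.IsWeakCertificate F C) : G.IsPopularBase F :=
  ⟨hC.base, fun _ hB => (hC.slackness hG hB).1⟩

namespace IsPadding

variable {G : ColorfulGraph U E n} {b : Fin n → E}

theorem isBase_iff (hb : G.IsPadding b) {B : Finset E} :
    G.truncation.IsBase (B : Set E) ↔ G.Indep B ∧ B.card = n := by
  constructor
  · intro h
    have hB := G.truncation_indep.1 h.indep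
    refine ⟨hB, ?_⟩
    have h1 : (B.card : ℕ∞) = G.truncation.eRk ((Finset.univ : Finset E) : Set E) := by
      rw [Finset.coe_univ, Matroid.eRk_univ_eq, ← h.encard_eq_eRank,
        Set.encard_coe_eq_coe_finsetCard]
    rw [eRk_truncation, hb.rank_univ] at h1
    exact_mod_cast h1
  · rintro ⟨h, hcard⟩
    rw [← truncation_indep] at h
    refine h.isBase_of_ground_subset_closure ?_
    rw [truncation_indep] at h
    rw [← coe_span, Finset.univ_subset_iff.1 (h.subset_span_of_rank_le (Finset.subset_univ _)
      (by rw [hb.rank_univ, hcard])), Finset.coe_univ]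
    exact Set.subset_univ _

/-- A popular colourful base has a certificate. -/
theorem exists_isWeakCertificate (hb : G.IsPadding b) {F : Finset E} (hF : G.IsPopularBase F) :
    ∃ D, G.IsWeakCertificate F D := by
  obtain ⟨x, hx, hFx⟩ := hF.1.exists_eq_image
  obtain ⟨a, y, hy, hmax⟩ := G.truncation.exists_weight_splitting G.color
    (fun e => G.vote e (x (G.color e))) b hb.color_eq
    (hb.isBase_iff.2 ⟨hb.isColorfulBase_image.indep, hb.isColorfulBase_image.2⟩)
  set v : E → ℤ := fun e => G.vote e (x (G.color e)) - a (G.color e) with hv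
  have hBy : G.IsColorfulBase (Finset.univ.image y) :=
    (G.isColorfulBase_image_iff hy).2 (hb.isBase_iff.1 hmax.1).1
  have hvx : ∀ i, v (x i) = -a i := fun i => by
    simp [hv, hx, vote_self]
  -- The potential contributes the same to all colourful bases. The votes of `F` against itself sum
  -- to 0, and by popularity those of `y` sum to at most 0, so `F` is as heavy as the optimal base.
  have hmaxF : G.truncation.IsMaxBase v F := by
    refine ⟨hb.isBase_iff.2 ⟨hF.1.indep, hF.1.2⟩, fun B hB => (hmax.2 B hB).trans ?_⟩
    have hpop := hF.2 _ hBy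
    have hphi := G.phi_sub_phi hy hx
    rw [← hFx] at hphi
    rw [hFx, Finset.sum_image fun i _ j _ h => injective_of_color hx h,
      Finset.sum_image fun i _ j _ h => injective_of_color hy h]
    have h1 : ∑ i, v (x i) = -∑ i, a i := by simp only [hvx, Finset.sum_neg_distrib]
    have h2 : ∑ i, v (y i) = ∑ i, G.vote (y i) (x i) - ∑ i, a i := by
      simp only [hv, hy, Finset.sum_sub_distrib]
    change ∑ i, v (y i) ≤ ∑ i, v (x i)
    omega
  obtain ⟨K, hK⟩ : ∃ K : ℕ, ∀ e, |v e| ≤ K := by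
    refine ⟨∑ e, (v e).natAbs, fun e => ?_⟩
    rw [Int.abs_eq_natAbs]
    exact_mod_cast Finset.single_le_sum (f := fun e => (v e).natAbs) (fun _ _ => Nat.zero_le _)
      (Finset.mem_univ e)
  simp only [abs_le] at hK
  let S : ℤ → Finset E := fun t => F.filter fun f => t ≤ v f
  have hS : ∀ s t, s ≤ t → S t ⊆ S s := fun s t hst f hf => by
    simp only [S, Finset.mem_filter] at hf ⊢
    exact ⟨hf.1, hst.trans hf.2⟩
  have hmemS : ∀ e, e ∈ G.span (S (v e)) := fun e =>
    G.mem_span_iff.2 (hmaxF.mem_closure (Set.mem_univ e))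
  -- The thresholds run from `K` at `j = 1` down to `-K` at `j = 2K + 1`, covering all weights. Thus
  -- `K + 1 - lev` bounds `v` from above, with equality on `F`.
  let D : EdgeChain E := ⟨2 * K + 1, fun j => G.span (S (K - j + 1))⟩
  have hD : D.IsMultichain := by
    refine ⟨by simp [D], fun i _ _ => G.span_mono (hS _ _ (by push_cast; omega)), ?_⟩
    refine Finset.univ_subset_iff.1 fun e _ => ?_
    refine G.span_mono (hS _ _ ?_) (hmemS e)
    have := (hK e).1
    simp only [D]
    push_cast
    omega
  have hlev : ∀ e, v e ≤ K + 1 - lev D e := by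
    intro e
    by_contra! hlt
    obtain ⟨h1, h2, h3⟩ := hD.lev_spec e
    have h4 := (hK e).2
    have h5 : lev D e ≤ lev D e - 1 :=
      lev_le (by omega) (by omega) (G.span_mono (hS _ _ (by omega)) (hmemS e))
    omega
  have hlevF : ∀ e ∈ F, v e = K + 1 - lev D e := by
    intro e he
    refine le_antisymm (hlev e) ?_
    by_contra! hlt
    have h1 : e ∉ S (K - lev D e + 1) := fun h => by
      have := (Finset.mem_filter.1 h).2
      omega
    exact (hF.1.indep.mono (Finset.insert_subset he (Finset.filter_subset _ _))).notMem_span h1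
      (hD.lev_spec e).2.2
  refine ⟨D, hD, hF.1, fun f hf => ?_, fun i h1 h2 => ?_⟩
  · rw [mem_edgesOf_iff]
    intro e hef
    -- The potential cancels within a colour: the vote is `v e - v f`.
    have hvote : G.vote e f ≤ lev D f - lev D e := by
      have hfx : f = x (G.color f) := by
        obtain ⟨i, -, rfl⟩ := Finset.mem_image.1 (hFx ▸ hf)
        rw [hx]
      have h1 := hlev e
      have h2 := hlevF f hf
      have h3 : v e = G.vote e f - a (G.color f) := by
        simp only [hv]
        rw [hef, ← hfx]
      have h4 : v f = -a (G.color f) := by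
        conv_lhs => rw [hfx]
        exact hvx _
      omega
    have hge := G.neg_one_le_vote e f
    exact ⟨by omega, fun h => pref_of_vote_neg (by omega),
      fun h => hb.ranked.not_pref_of_vote_nonpos hef (by omega)⟩
  · apply subset_antisymm
    · exact G.span_subset_span Finset.inter_subset_right
    · exact G.span_mono (Finset.subset_inter (Finset.filter_subset _ _) (G.subset_span _))

end IsPadding

/-- The popular colourful bases are exactly the colourful bases in the face of the multichain
returned by the algorithm. -/
theorem Returns.isPopularBase_iff {G : ColorfulGraph U E n} {b : Fin n → E} (hb : G.IsPadding b)
    {F : Finset E} {C : EdgeChain E} (h : G.Returns F C) {B : Finset E} :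
    G.IsPopularBase B ↔ G.IsColorfulBase B ∧ B ⊆ G.edgesOf C ∧
      ∀ i, 1 ≤ i → i ≤ C.len → (B ∩ C.set i).card = G.rank (C.set i) := by
  have hC := h.isWeakCertificate hb
  constructor
  · intro hB
    obtain ⟨hs1, hs2⟩ := (hC.slackness hb.ranked hB.1).2 (hB.2 F hC.base)
    refine ⟨hB.1, fun e he => ?_, hs2⟩
    -- A shortest certificate of `B` has at most two levels, and the levels of `𝒞` lie below its
    -- levels.
    have hex : ∃ p, ∃ D, G.IsWeakCertificate B D ∧ D.len = p := by
      obtain ⟨D, hD⟩ := hb.exists_isWeakCertificate hB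
      exact ⟨_, D, hD, rfl⟩
    obtain ⟨D, hD, hlen⟩ := Nat.find_spec hex
    have hmin : ∀ D', G.IsWeakCertificate B D' → D.len ≤ D'.len := fun D' hD' =>
      hlen ▸ Nat.find_min' hex ⟨D', hD', rfl⟩
    have h2 := (hD.len_le_two hb hmin).1
    have hle := lev_le_lev hC.toIsMultichain hD.toIsMultichain
      (h.1.le_certificate hb.ranked hD).2
    by_cases heq : lev C e = lev D e
    · exact mem_edgesOf_of_lev_eq hb.ranked hle (hD.subset he) heq
    obtain ⟨x, hx, hFx⟩ := hC.base.exists_eq_image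
    set f := x (G.color e) with hf
    have hfF : f ∈ F := hFx ▸ Finset.mem_image_of_mem _ (Finset.mem_univ _)
    have hfe : G.color f = G.color e := hx _
    have hv1 := hs1 e he f hfF hfe.symm
    have hv2 := ((hD.slackness hb.ranked hC.base).2
      ((hC.isPopularBase hb.ranked).2 B hB.1)).1 f hfF e he hfe
    rw [vote_comm] at hv2
    have hl1 := hle e
    have hl2 := (hC.lev_spec e).1
    have hl3 := (hC.lev_spec f).1
    have hl4 := (hD.lev_spec e).2.1
    have hl5 := (hD.lev_spec f).2.1
    have hfC := G.mem_edgesOf_iff.1 (hC.subset hfF)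
    -- Here `e` has level 1 in `𝒞` and 2 in `D`. Slackness for `𝒞` makes the vote of `e` against `f`
    -- nonnegative, slackness for `D` makes it nonpositive; so `e` and `f` tie.
    have hlev : lev C f = lev C e := by omega
    have hnef : ¬ G.pref e f := hb.ranked.not_pref_of_vote_nonpos hfe.symm (by omega)
    have hnfe : ¬ G.pref f e := hb.ranked.not_pref_of_vote_nonpos hfe (by
      rw [vote_comm]
      omega)
    rw [mem_edgesOf_iff]
    intro g hg
    obtain ⟨h3, h4, h5⟩ := hfC g (hg.trans hfe.symm)
    refine ⟨by omega, fun h6 => ?_, fun h6 h7 => ?_⟩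
    -- Negative transitivity transfers the comparisons with `g` from `f` to the tied edge `e`.
    · exact (hb.ranked.negTrans (hfe.trans hg.symm) hg.symm (h4 (by omega))).resolve_left hnfe
    · exact (hb.ranked.negTrans hg hfe h7).elim (h5 (by omega)) hnfe
  · rintro ⟨hB, hsub, hrank⟩
    refine IsWeakCertificate.isPopularBase hb.ranked
      (C := C) ⟨hC.toIsMultichain, hB, hsub, fun i h1 h2 => ?_⟩
    have hcl : G.span (C.set i) = C.set i := by
      rw [← hC.span_eq i h1 h2, span_span]
    apply subset_antisymm
    · exact (G.span_mono Finset.inter_subset_right).trans_eq hcl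
    · exact (hB.indep.mono Finset.inter_subset_left).subset_span_of_rank_le
        Finset.inter_subset_right (hrank i h1 h2).ge

end

end ColorfulGraph

namespace ColorfulGraph

noncomputable section

open scoped Classical

/-! ### The face of the common base polytope -/

/-- A proper convex combination attains the upper bound of `l` only if both points do. Hence the
auxiliary set `T`, which contains `s`, is convex. -/
theorem mem_convexHull_face {V : Type*} [AddCommGroup V] [Module ℝ V] {s : Set V} (l : V →ₗ[ℝ] ℝ)
    {c : ℝ} (hs : ∀ y ∈ s, l y ≤ c) {x : V} (hx : x ∈ convexHull ℝ s) (hlx : l x = c) :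
    x ∈ convexHull ℝ {y ∈ s | l y = c} := by
  let T : Set V := {y | l y ≤ c ∧ (l y = c → y ∈ convexHull ℝ {y ∈ s | l y = c})}
  have hsT : s ⊆ T := fun y hy => ⟨hs y hy, fun h => subset_convexHull ℝ _ ⟨hy, h⟩⟩
  have hT : Convex ℝ T := by
    rintro y ⟨hy1, hy2⟩ z ⟨hz1, hz2⟩ p q hp hq hpq
    rcases hp.eq_or_lt with rfl | hp
    · obtain rfl : q = 1 := by linarith
      simpa using ⟨hz1, hz2⟩
    rcases hq.eq_or_lt with rfl | hq
    · obtain rfl : p = 1 := by linarith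
      simpa using ⟨hy1, hy2⟩
    have h1 : p * l y ≤ p * c := mul_le_mul_of_nonneg_left hy1 hp.le
    have h2 : q * l z ≤ q * c := mul_le_mul_of_nonneg_left hz1 hq.le
    have h3 : p * c + q * c = c := by rw [← add_mul, hpq, one_mul]
    refine ⟨by simp only [map_add, map_smul, smul_eq_mul]; linarith, fun h => ?_⟩
    simp only [map_add, map_smul, smul_eq_mul] at h
    refine convex_convexHull ℝ _ (hy2 ?_) (hz2 ?_) hp.le hq.le hpq
    · exact mul_left_cancel₀ hp.ne' (by linarith)
    · exact mul_left_cancel₀ hq.ne' (by linarith)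
  exact (convexHull_min hsT hT hx).2 hlx

variable {U E : Type*} {n : ℕ}

theorem rank_mono (G : ColorfulGraph U E n) {S T : Finset E} (h : S ⊆ T) : G.rank S ≤ G.rank T := by
  obtain ⟨I, hIS, hI, hc⟩ := G.exists_card_eq_rank S
  exact hc ▸ G.le_rank hI (hIS.trans h)

theorem sum_indicator (S B : Finset E) :
    ∑ e ∈ S, Set.indicator (B : Set E) (1 : E → ℝ) e = ((B ∩ S).card : ℝ) := by
  rw [Finset.inter_comm, ← Finset.filter_mem_eq_inter, ← Finset.sum_boole]
  refine Finset.sum_congr rfl fun e _ => ?_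
  simp [Set.indicator_apply]

variable [Fintype E]

section Polytope

variable {G : ColorfulGraph U E n}

theorem sum_color_mul {x : E → ℝ} (hx : x ∈ G.commonBasePolytope) (a : Fin n → ℝ) :
    ∑ e, a (G.color e) * x e = ∑ i, a i := by
  rw [← Finset.sum_fiberwise Finset.univ G.color]
  refine Finset.sum_congr rfl fun i _ => ?_
  rw [Finset.sum_congr rfl fun e he => by rw [(Finset.mem_filter.1 he).2], ← Finset.mul_sum,
    hx.1 i, mul_one]

/-- On the common base polytope, a weight function is bounded by its maximum over the bases. -/
theorem sum_mul_le_of_isMaxBase {v : E → ℤ} {B : Finset E} (hB : G.truncation.IsMaxBase v B)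
    (hcard : B.card = n) {x : E → ℝ} (hx : x ∈ G.commonBasePolytope) :
    ∑ e, (v e : ℝ) * x e ≤ ∑ e ∈ B, (v e : ℝ) := by
  obtain ⟨K, hK⟩ : ∃ K : ℕ, ∀ e, |v e| ≤ K := by
    refine ⟨∑ e, (v e).natAbs, fun e => ?_⟩
    rw [Int.abs_eq_natAbs]
    exact_mod_cast Finset.single_le_sum (f := fun e => (v e).natAbs) (fun _ _ => Nat.zero_le _)
      (Finset.mem_univ e)
  simp only [abs_le] at hK
  -- Layer-cake decomposition: it reduces the claim to the rank constraints on the superlevel sets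
  -- of `v`, which are tight for `B`.
  have hv : ∀ e, (v e : ℝ) = ∑ t ∈ Finset.Ioc (-K : ℤ) K, (if t ≤ v e then (1 : ℝ) else 0) - K := by
    intro e
    have h1 : ((Finset.Ioc (-K : ℤ) K).filter fun t => t ≤ v e) = Finset.Ioc (-K : ℤ) (v e) := by
      ext t
      have := (hK e).2
      simp only [Finset.mem_filter, Finset.mem_Ioc]
      omega
    have h2 : (((v e - -K).toNat : ℤ) : ℝ) = ((v e + K : ℤ) : ℝ) := by
      congr 1
      have := (hK e).1
      omega
    rw [Finset.sum_boole, h1, Int.card_Ioc]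
    push_cast at h2 ⊢
    rw [h2]
    ring
  have hsum : ∑ e, x e = n := by
    simpa using sum_color_mul hx fun _ => 1
  have hB' : G.Indep B := G.truncation_indep.1 hB.1.indep
  have hL : ∑ e, (v e : ℝ) * x e =
      ∑ t ∈ Finset.Ioc (-K : ℤ) K, ∑ e ∈ Finset.univ.filter (fun e => t ≤ v e), x e - K * n := by
    simp only [hv, sub_mul, Finset.sum_sub_distrib, ← Finset.mul_sum, hsum, Finset.sum_mul,
      ite_mul, one_mul, zero_mul]
    rw [Finset.sum_comm]
    simp only [Finset.sum_filter]
  have hR : ∑ e ∈ B, (v e : ℝ) =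
      ∑ t ∈ Finset.Ioc (-K : ℤ) K, ((B.filter fun e => t ≤ v e).card : ℝ) - K * n := by
    simp only [hv, Finset.sum_sub_distrib, Finset.sum_const, hcard, nsmul_eq_mul]
    rw [Finset.sum_comm]
    simp only [Finset.sum_boole]
    ring
  rw [hL, hR]
  refine sub_le_sub_right (Finset.sum_le_sum fun t _ => ?_) _
  refine (hx.2.1 _).trans ?_
  have hspan : (Finset.univ.filter fun e => t ≤ v e) ⊆ G.span (B.filter fun e => t ≤ v e) := by
    intro e he
    rw [Finset.mem_filter] at he
    refine G.span_mono (S := B.filter fun f => v e ≤ v f) (fun f hf => ?_)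
      (G.mem_span_iff.2 (hB.mem_closure (Set.mem_univ e)))
    rw [Finset.mem_filter] at hf ⊢
    exact ⟨hf.1, he.2.trans hf.2⟩
  rw [← G.rank_span_of_indep (hB'.mono (Finset.filter_subset _ _))]
  exact_mod_cast G.rank_mono hspan

/-- The matroid intersection polytope is integral. -/
theorem commonBasePolytope_subset {b : Fin n → E} (hb : G.IsPadding b) :
    G.commonBasePolytope ⊆
      convexHull ℝ {y | ∃ B : Finset E, G.IsColorfulBase B ∧ y = Set.indicator (B : Set E) 1} := by
  intro x hx
  by_contra hcon
  have hfin : {y : E → ℝ | ∃ B : Finset E, G.IsColorfulBase B ∧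
      y = Set.indicator (B : Set E) 1}.Finite :=
    (Set.finite_range fun B : Finset E => Set.indicator (B : Set E) (1 : E → ℝ)).subset
      fun y ⟨B, _, hy⟩ => ⟨B, hy.symm⟩
  obtain ⟨l, u, hl, hu⟩ := geometric_hahn_banach_closed_point (convex_convexHull ℝ _)
    (hfin.isClosed_convexHull ℝ) hcon
  have hlsum : ∀ y : E → ℝ, l y = ∑ e, l (Pi.single e 1) * y e := by
    intro y
    conv_lhs => rw [pi_eq_sum_univ' y]
    simp only [map_sum, map_smul, smul_eq_mul]
    refine Finset.sum_congr rfl fun e _ => ?_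
    rw [mul_comm]
  -- Weight splitting needs integer weights. Scaling the separating functional by `N` makes the gap
  -- exceed `n`, which bounds the rounding loss at `x` because the coordinates of `x` sum to `n`.
  obtain ⟨N, hN⟩ := exists_nat_gt ((n : ℝ) / (l x - u))
  rw [div_lt_iff₀ (by linarith)] at hN
  obtain ⟨a, y, hy, hmax⟩ := G.truncation.exists_weight_splitting G.color
    (fun e => ⌊(N : ℝ) * l (Pi.single e 1)⌋) b hb.color_eq
    (hb.isBase_iff.2 ⟨hb.isColorfulBase_image.indep, hb.isColorfulBase_image.2⟩)
  have hbase : G.IsColorfulBase (Finset.univ.image y) :=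
    (G.isColorfulBase_image_iff hy).2 (hb.isBase_iff.1 hmax.1).1
  have hle := sum_mul_le_of_isMaxBase hmax hbase.2 hx
  have hly := hl _ (subset_convexHull ℝ _ ⟨_, hbase, rfl⟩)
  have hlB : l (Set.indicator ((Finset.univ.image y : Finset E) : Set E) 1) =
      ∑ e ∈ Finset.univ.image y, l (Pi.single e 1) := by
    rw [hlsum, ← Finset.sum_filter_add_sum_filter_not Finset.univ (· ∈ Finset.univ.image y)]
    rw [Finset.sum_eq_zero (s := Finset.univ.filter fun e => ¬ e ∈ Finset.univ.image y), add_zero]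
    · rw [Finset.filter_univ_mem]
      exact Finset.sum_congr rfl fun e he => by
        rw [Set.indicator_of_mem (by exact_mod_cast he), Pi.one_apply, mul_one]
    · intro e he
      rw [Set.indicator_of_notMem (by exact_mod_cast (Finset.mem_filter.1 he).2), mul_zero]
  have hsum : ∑ e, x e = n := by
    simpa using sum_color_mul hx fun _ => 1
  have h1 : ∑ i, (a i : ℝ) = ∑ e ∈ Finset.univ.image y, (a (G.color e) : ℝ) := by
    rw [Finset.sum_image fun i _ j _ h => injective_of_color hy h]
    simp only [hy]
  have h2 := sum_color_mul hx fun i => (a i : ℝ)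
  have h3 : ∑ e ∈ Finset.univ.image y, (⌊(N : ℝ) * l (Pi.single e 1)⌋ : ℝ) ≤
      N * ∑ e ∈ Finset.univ.image y, l (Pi.single e 1) := by
    rw [Finset.mul_sum]
    exact Finset.sum_le_sum fun e _ => Int.floor_le _
  have h4 : N * l x - n ≤ ∑ e, (⌊(N : ℝ) * l (Pi.single e 1)⌋ : ℝ) * x e := by
    rw [hlsum, ← hsum, Finset.mul_sum, ← Finset.sum_sub_distrib]
    refine Finset.sum_le_sum fun e _ => ?_
    have h5 := (Int.sub_one_lt_floor ((N : ℝ) * l (Pi.single e 1))).le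
    have h6 := mul_le_mul_of_nonneg_right h5 (hx.2.2 e)
    linarith
  push_cast at hle
  simp only [sub_mul, Finset.sum_sub_distrib] at hle
  have h5 : (N : ℝ) * ∑ e ∈ Finset.univ.image y, l (Pi.single e 1) ≤ N * u :=
    mul_le_mul_of_nonneg_left (hlB ▸ hly.le) (Nat.cast_nonneg N)
  linarith

theorem convex_chainFace (C : EdgeChain E) : Convex ℝ (G.chainFace C) := by
  rintro x ⟨⟨hx1, hx2, hx3⟩, hx4, hx5⟩ y ⟨⟨hy1, hy2, hy3⟩, hy4, hy5⟩ p q hp hq hpq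
  have hsum : ∀ S : Finset E, ∑ e ∈ S, (p • x + q • y) e = p * ∑ e ∈ S, x e + q * ∑ e ∈ S, y e := by
    intro S
    simp only [Pi.add_apply, Pi.smul_apply, smul_eq_mul, Finset.sum_add_distrib, Finset.mul_sum]
  refine ⟨⟨fun i => ?_, fun S => ?_, fun e => ?_⟩, fun i h1 h2 => ?_, fun e he => ?_⟩
  · rw [hsum, hx1, hy1, mul_one, mul_one, hpq]
  · rw [hsum]
    calc _ ≤ p * (G.rank S : ℝ) + q * G.rank S := by
          gcongr
          exacts [hx2 S, hy2 S]
      _ = _ := by rw [← add_mul, hpq, one_mul]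
  · have := hx3 e
    have := hy3 e
    simp only [Pi.add_apply, Pi.smul_apply, smul_eq_mul]
    positivity
  · rw [hsum, hx4 i h1 h2, hy4 i h1 h2, ← add_mul, hpq, one_mul]
  · simp [hx5 e he, hy5 e he]

theorem chainFace_eq_convexHull {b : Fin n → E} (hb : G.IsPadding b) (C : EdgeChain E) :
    G.chainFace C = convexHull ℝ {y | ∃ B : Finset E, (G.IsColorfulBase B ∧ B ⊆ G.edgesOf C ∧
      ∀ i, 1 ≤ i → i ≤ C.len → (B ∩ C.set i).card = G.rank (C.set i)) ∧
      y = Set.indicator (B : Set E) 1} := by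
  apply subset_antisymm
  · rintro x ⟨hx, hxC, hx0⟩
    -- One functional encodes all the equations: on the bases it is at most the sum of the ranks,
    -- with equality only if every `C_i` is tight and no edge outside E(𝒞) is used.
    let l : (E → ℝ) →ₗ[ℝ] ℝ := ∑ i ∈ Finset.Icc 1 C.len, ∑ e ∈ C.set i, LinearMap.proj e -
      ∑ e ∈ (G.edgesOf C)ᶜ, LinearMap.proj e
    have hl : ∀ y, l y = ∑ i ∈ Finset.Icc 1 C.len, ∑ e ∈ C.set i, y e -
        ∑ e ∈ (G.edgesOf C)ᶜ, y e := fun y => by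
      simp [l]
    have hlB : ∀ B : Finset E, G.IsColorfulBase B →
        (∀ i ∈ Finset.Icc 1 C.len, ((B ∩ C.set i).card : ℝ) ≤ G.rank (C.set i)) :=
      fun B hB i _ => by
        exact_mod_cast G.le_rank (hB.indep.mono Finset.inter_subset_left) Finset.inter_subset_right
    refine convexHull_mono ?_ (mem_convexHull_face l
      (c := ∑ i ∈ Finset.Icc 1 C.len, (G.rank (C.set i) : ℝ)) ?_ (commonBasePolytope_subset hb hx) ?_)
    · rintro y ⟨⟨B, hB, rfl⟩, hy⟩
      rw [hl] at hy
      simp only [sum_indicator] at hy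
      have h1 := Finset.sum_le_sum (hlB B hB)
      have h2 : (0 : ℝ) ≤ ((B ∩ (G.edgesOf C)ᶜ).card : ℝ) := Nat.cast_nonneg _
      have h3 : ((B ∩ (G.edgesOf C)ᶜ).card : ℝ) = 0 := by linarith
      refine ⟨B, ⟨hB, ?_, fun i h4 h5 => ?_⟩, rfl⟩
      · rw [Nat.cast_eq_zero, Finset.card_eq_zero, ← Finset.disjoint_iff_inter_eq_empty,
          disjoint_compl_right_iff] at h3
        exact h3
      · have := (Finset.sum_eq_sum_iff_of_le (hlB B hB)).1 (by linarith) i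
          (Finset.mem_Icc.2 ⟨h4, h5⟩)
        exact_mod_cast this
    · rintro y ⟨B, hB, rfl⟩
      rw [hl]
      simp only [sum_indicator]
      have h1 := Finset.sum_le_sum (hlB B hB)
      have h2 : (0 : ℝ) ≤ ((B ∩ (G.edgesOf C)ᶜ).card : ℝ) := Nat.cast_nonneg _
      linarith
    · rw [hl, Finset.sum_eq_zero fun e he => hx0 e (Finset.mem_compl.1 he), sub_zero]
      exact Finset.sum_congr rfl fun i hi => hxC i (Finset.mem_Icc.1 hi).1 (Finset.mem_Icc.1 hi).2
  · refine convexHull_min ?_ (convex_chainFace C)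
    rintro _ ⟨B, ⟨hB, hsub, hrank⟩, rfl⟩
    refine ⟨⟨fun i => ?_, fun S => ?_, fun e => Set.indicator_nonneg (by simp) e⟩,
      fun i h1 h2 => by rw [sum_indicator, hrank i h1 h2],
      fun e he => Set.indicator_of_notMem (fun h => he (hsub (by exact_mod_cast h))) _⟩
    · rw [sum_indicator]
      obtain ⟨x, hx, rfl⟩ := hB.exists_eq_image
      have : Finset.univ.image x ∩ Finset.univ.filter (fun e => G.color e = i) = {x i} := by
        ext e
        simp only [Finset.mem_inter, Finset.mem_image, Finset.mem_univ, true_and,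
          Finset.mem_filter, Finset.mem_singleton]
        constructor
        · rintro ⟨⟨j, rfl⟩, h⟩
          rw [← h, hx]
        · rintro rfl
          exact ⟨⟨i, rfl⟩, hx i⟩
      rw [this, Finset.card_singleton, Nat.cast_one]
    · rw [sum_indicator]
      exact_mod_cast G.le_rank (hB.indep.mono Finset.inter_subset_left) Finset.inter_subset_right

end Polytope

end

end ColorfulGraph

namespace ColorfulGraph

noncomputable section

open scoped Classical

variable {U E : Type*} {n : ℕ}

/-! ### Popular colourful forests and popular colourful bases of the padded instance -/

theorem padded_isRanked {H : ColorfulGraph U E n} (hweak : H.WeakRankings) :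
    H.padded.IsRanked where
  asymm := by
    rintro (e | i) (f | j) hef h1 h2
    · have := hweak (H.color f)
      have h3 : H.color e = H.color f := hef
      exact (Std.Irrefl.irrefl (r := fun e f : {e // H.color e = H.color f} => H.pref e f)
        ⟨e, h3⟩) (IsTrans.trans (r := fun e f : {e // H.color e = H.color f} => H.pref e f)
          ⟨e, h3⟩ ⟨f, rfl⟩ ⟨e, h3⟩ h1 h2)
    · exact h2
    · exact h1
    · exact h1
  negTrans := by
    rintro (e | i) (f | j) (g | k) hef hgf h
    · have := hweak (H.color f)
      have h3 : H.color e = H.color f := hef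
      have h4 : H.color g = H.color f := hgf
      let r := fun e f : {e // H.color e = H.color f} => H.pref e f
      by_contra! hcon
      obtain ⟨h5 : ¬ H.pref e g, h6 : ¬ H.pref g f⟩ := hcon
      have h7 : ¬ H.pref g e := fun h7 =>
        h6 (IsTrans.trans (r := r) ⟨g, h4⟩ ⟨e, h3⟩ ⟨f, rfl⟩ h7 h)
      have h8 : ¬ H.pref f g := fun h8 =>
        h5 (IsTrans.trans (r := r) ⟨e, h3⟩ ⟨f, rfl⟩ ⟨g, h4⟩ h h8)
      exact (IsStrictWeakOrder.incomp_trans (lt := r) ⟨e, h3⟩ ⟨g, h4⟩ ⟨f, rfl⟩ ⟨h5, h7⟩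
        ⟨h6, h8⟩).1 h
    · exact Or.inl ((show H.color e = H.color f from hef).trans
        (show k = H.color f from hgf).symm)
    · exact Or.inr hgf
    · exact Or.inl ((show H.color e = j from hef).trans (show k = j from hgf).symm)
    · exact absurd h id
    · exact absurd h id
    · exact absurd h id
    · exact absurd h id

theorem padded_eq_inr_of_mem_ends {H : ColorfulGraph U E n} {e : E ⊕ Fin n} {i : Fin n}
    {u : Fin n ⊕ Fin n} (hu : u = Sum.inl i ∨ u = Sum.inr i) (h : Sum.inr u ∈ H.padded.ends e) :
    e = Sum.inr i := by
  rcases e with e | j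
  · obtain ⟨v, -, hv⟩ := Sym2.mem_map.1 (show Sum.inr u ∈ (H.ends e).map Sum.inl from h)
    exact absurd hv Sum.inl_ne_inr
  · have h' : Sum.inr u ∈ s((Sum.inr (Sum.inl j) : U ⊕ (Fin n ⊕ Fin n)), Sum.inr (Sum.inr j)) := h
    rcases Sym2.mem_iff.1 h' with h' | h' <;> have h' := Sum.inr_injective h' <;>
      rcases hu with rfl | rfl <;> simp_all

theorem padded_isPadding {H : ColorfulGraph U E n} (hloop : H.Loopless) (hweak : H.WeakRankings) :
    H.padded.IsPadding Sum.inr where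
  ranked := padded_isRanked hweak
  color_eq _ := rfl
  worst {e} he := by
    rcases e with e | i
    · exact rfl
    · exact absurd rfl he
  loopless := by
    rintro e ⟨k, x, c, -, hc, hS⟩
    -- A cycle within a single edge has length one, so the edge would be a loop.
    have hk : (0 : Fin (k + 1)) + 1 = 0 := hc (by
      rw [Finset.mem_singleton.1 (hS (0 + 1)).1, Finset.mem_singleton.1 (hS 0).1])
    have h0 := (hS 0).2
    rw [hk, Finset.mem_singleton.1 (hS 0).1] at h0
    have hdiag : (H.padded.ends e).IsDiag := h0 ▸ Sym2.mk_isDiag_iff.2 rfl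
    rcases e with e | i
    · exact hloop e ((Sym2.isDiag_map Sum.inl_injective).1 hdiag)
    · have h1 : (s((Sum.inr (Sum.inl i) : U ⊕ (Fin n ⊕ Fin n)), Sum.inr (Sum.inr i))).IsDiag := hdiag
      simp at h1
  coloop {S} i hS := by
    rintro ⟨k, x, c, hx, hc, hS'⟩
    refine hS ⟨k, x, c, hx, hc, fun j => ⟨((@Finset.mem_insert _ (_) _ _ _).1 (hS' j).1).resolve_left
      fun hj => ?_, (hS' j).2⟩⟩
    have h0 := (hS' j).2
    rw [hj] at h0
    have h1 : s((Sum.inr (Sum.inl i) : U ⊕ (Fin n ⊕ Fin n)), Sum.inr (Sum.inr i)) =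
      s(x j, x (j + 1)) := h0
    have h2 : ∃ u, (u = Sum.inl i ∨ u = Sum.inr i) ∧ x (j + 1) = Sum.inr u := by
      rcases Sym2.eq_iff.1 h1 with ⟨-, h⟩ | ⟨h, -⟩
      · exact ⟨_, Or.inr rfl, h.symm⟩
      · exact ⟨_, Or.inl rfl, h.symm⟩
    obtain ⟨u, hu, hxu⟩ := h2
    -- The cycle would have to leave `e_i` through an end that meets no other edge.
    have h3 := padded_eq_inr_of_mem_ends (e := c (j + 1)) hu (by
      rw [(hS' (j + 1)).2, ← hxu]
      exact Sym2.mem_mk_left _ _)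
    rw [hc (h3.trans hj.symm)] at h1
    rcases Sym2.eq_iff.1 h1 with ⟨h4, h5⟩ | ⟨h4, h5⟩ <;> simpa using h4.trans h5.symm

theorem padded_isForest_map_iff (H : ColorfulGraph U E n) (S : Finset E) :
    H.padded.IsForest (S.map Function.Embedding.inl) ↔ H.IsForest S := by
  refine not_congr ⟨?_, ?_⟩
  · rintro ⟨k, x, c, hx, hc, hS⟩
    have hcE : ∀ j, ∃ e ∈ S, Sum.inl e = c j := fun j => by
      simpa using Finset.mem_map.1 (hS j).1
    choose d hdS hd using hcE
    have hends : ∀ j, (H.ends (d j)).map Sum.inl = s(x j, x (j + 1)) := fun j => by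
      rw [← (hS j).2, ← hd j]
      rfl
    have hxU : ∀ j, ∃ u, Sum.inl u = x j := fun j => by
      have h1 : x j ∈ (H.ends (d j)).map Sum.inl := by
        rw [hends]
        exact Sym2.mem_mk_left _ _
      obtain ⟨u, -, hu⟩ := Sym2.mem_map.1 h1
      exact ⟨u, hu⟩
    choose y hy using hxU
    refine ⟨k, y, d, fun i j hij => hx (by rw [← hy, ← hy, hij]),
      fun i j hij => hc (by rw [← hd, ← hd, hij]), fun j => ⟨hdS j, ?_⟩⟩
    refine Sym2.map.injective Sum.inl_injective ((hends j).trans ?_)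
    rw [← hy, ← hy, Sym2.map_mk]
  · rintro ⟨k, x, c, hx, hc, hS⟩
    refine ⟨k, fun j => Sum.inl (x j), fun j => Sum.inl (c j),
      fun i j hij => hx (Sum.inl_injective hij), fun i j hij => hc (Sum.inl_injective hij),
      fun j => ⟨Finset.mem_map_of_mem Function.Embedding.inl (hS j).1, ?_⟩⟩
    change (H.ends (c j)).map Sum.inl = _
    rw [(hS j).2, Sym2.map_mk]

variable [Fintype E]

/-- The colourful base of the padded instance that extends a colourful forest. -/
def pad (H : ColorfulGraph U E n) (F : Finset E) : Finset (E ⊕ Fin n) :=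
  Finset.univ.filter fun e => Sum.elim (fun e => e ∈ F) (fun i => ∀ f ∈ F, H.color f ≠ i) e

@[simp]
theorem inl_mem_pad {H : ColorfulGraph U E n} {F : Finset E} {e : E} :
    Sum.inl e ∈ H.pad F ↔ e ∈ F := by
  simp [pad]

@[simp]
theorem inr_mem_pad {H : ColorfulGraph U E n} {F : Finset E} {i : Fin n} :
    Sum.inr i ∈ H.pad F ↔ ∀ f ∈ F, H.color f ≠ i := by
  simp [pad]

theorem isColorfulBase_pad_iff {H : ColorfulGraph U E n} (hloop : H.Loopless)
    (hweak : H.WeakRankings) {F : Finset E} :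
    H.padded.IsColorfulBase (H.pad F) ↔ H.IsColorfulForest F := by
  constructor
  · rintro ⟨⟨h1, h2⟩, -⟩
    refine ⟨(H.padded_isForest_map_iff F).1 (h1.mono fun e he => ?_), fun e he f hf hef => ?_⟩
    · obtain ⟨f, hf, rfl⟩ := Finset.mem_map.1 he
      exact inl_mem_pad.2 hf
    · exact Sum.inl_injective (h2 _ (inl_mem_pad.2 he) _ (inl_mem_pad.2 hf) hef)
  · rintro ⟨h1, h2⟩
    have hcol : ∀ e ∈ H.pad F, ∀ f ∈ H.pad F, H.padded.color e = H.padded.color f → e = f := by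
      rintro (e | i) he (f | j) hf hef
      · rw [h2 e (inl_mem_pad.1 he) f (inl_mem_pad.1 hf) hef]
      · exact absurd hef (inr_mem_pad.1 hf e (inl_mem_pad.1 he))
      · exact absurd hef.symm (inr_mem_pad.1 he f (inl_mem_pad.1 hf))
      · exact congrArg Sum.inr hef
    refine ⟨⟨?_, hcol⟩, ?_⟩
    · refine (padded_isPadding hloop hweak).isForest_of_forall_mem
        ((H.padded_isForest_map_iff F).2 h1) ?_
      rintro (e | i) he
      · exact Or.inl (Finset.mem_map_of_mem Function.Embedding.inl (inl_mem_pad.1 he))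
      · exact Or.inr ⟨i, rfl⟩
    · have himg : (H.pad F).image H.padded.color = Finset.univ := by
        refine Finset.eq_univ_of_forall fun i => ?_
        by_cases hi : ∃ f ∈ F, H.color f = i
        · obtain ⟨f, hf, rfl⟩ := hi
          exact Finset.mem_image.2 ⟨Sum.inl f, inl_mem_pad.2 hf, rfl⟩
        · push Not at hi
          exact Finset.mem_image.2 ⟨Sum.inr i, inr_mem_pad.2 hi, rfl⟩
      rw [← Finset.card_image_of_injOn (f := H.padded.color)
        (fun e he f hf h => hcol e he f hf h), himg, Finset.card_univ, Fintype.card_fin]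

/-- A colourful base has exactly one edge of each colour, so its edges in `H` determine which `e_i`
it contains. -/
theorem exists_eq_pad {H : ColorfulGraph U E n} {B : Finset (E ⊕ Fin n)}
    (hB : H.padded.IsColorfulBase B) : ∃ F, B = H.pad F := by
  refine ⟨Finset.univ.filter fun e => Sum.inl e ∈ B, ?_⟩
  ext e
  rcases e with e | i
  · simp
  · simp only [inr_mem_pad, Finset.mem_filter, Finset.mem_univ, true_and]
    constructor
    · intro hi f hf hfi
      exact absurd (hB.1.2 _ hf _ hi hfi) Sum.inl_ne_inr
    · intro h
      obtain ⟨f | j, he, hei⟩ := hB.exists_mem_color_eq i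
      · exact absurd hei (h f he)
      · rwa [← show j = i from hei]

/-- Being unmatched in `H` becomes holding the worst edge `e_i`; in padded sets no colour is absent,
so only the second clause of `Prefers` can apply. -/
theorem prefers_pad_iff (H : ColorfulGraph U E n) (F F' : Finset E) (i : Fin n) :
    H.padded.Prefers i (H.pad F) (H.pad F') ↔ H.Prefers i F F' := by
  constructor
  · rintro (⟨-, h⟩ | ⟨e, he, f, hf, hei, hfi, h⟩)
    · exfalso
      refine h (Sum.inr i) (inr_mem_pad.2 fun f hf hfi => ?_) rfl
      exact h (Sum.inl f) (inl_mem_pad.2 hf) hfi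
    · rcases e with e | j
      · rcases f with f | k
        · exact Or.inr ⟨e, inl_mem_pad.1 he, f, inl_mem_pad.1 hf, hei, hfi, h⟩
        · obtain rfl : k = i := hfi
          exact Or.inl ⟨⟨e, inl_mem_pad.1 he, hei⟩, inr_mem_pad.1 hf⟩
      · exact absurd h id
  · rintro (⟨⟨e, he, hei⟩, h⟩ | ⟨e, he, f, hf, hei, hfi, h⟩)
    · exact Or.inr ⟨Sum.inl e, inl_mem_pad.2 he, Sum.inr i, inr_mem_pad.2 h, hei, rfl, hei⟩
    · exact Or.inr ⟨Sum.inl e, inl_mem_pad.2 he, Sum.inl f, inl_mem_pad.2 hf, hei, hfi, h⟩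

theorem phi_pad (H : ColorfulGraph U E n) (F F' : Finset E) :
    H.padded.phi (H.pad F) (H.pad F') = H.phi F F' := by
  simp only [phi, prefers_pad_iff]

theorem isPopularBase_pad_iff {H : ColorfulGraph U E n} (hloop : H.Loopless)
    (hweak : H.WeakRankings) {F : Finset E} :
    H.padded.IsPopularBase (H.pad F) ↔ H.IsPopularForest F := by
  refine and_congr (isColorfulBase_pad_iff hloop hweak) ⟨fun h F' hF' => ?_, fun h B hB => ?_⟩
  · simpa only [phi_pad] using h _ ((isColorfulBase_pad_iff hloop hweak).2 hF')
  · obtain ⟨F', rfl⟩ := exists_eq_pad hB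
    simpa only [phi_pad] using h _ ((isColorfulBase_pad_iff hloop hweak).1 hB)

theorem image_chainFace_eq {H : ColorfulGraph U E n} (hloop : H.Loopless)
    (hweak : H.WeakRankings) {F : Finset (E ⊕ Fin n)} {C : EdgeChain (E ⊕ Fin n)}
    (hret : H.padded.Returns F C) :
    LinearMap.funLeft ℝ ℝ (Sum.inl : E → E ⊕ Fin n) '' H.padded.chainFace C =
      H.popularForestPolytope := by
  have hpad := padded_isPadding hloop hweak
  have hind : ∀ F : Finset E, LinearMap.funLeft ℝ ℝ (Sum.inl : E → E ⊕ Fin n)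
      (Set.indicator (H.pad F : Set (E ⊕ Fin n)) 1) = Set.indicator (F : Set E) 1 := fun F => by
    ext e
    simp [LinearMap.funLeft_apply, Set.indicator_apply]
  rw [chainFace_eq_convexHull hpad, LinearMap.image_convexHull, popularForestPolytope]
  simp only [← hret.isPopularBase_iff hpad]
  congr 1
  ext y
  constructor
  · rintro ⟨_, ⟨B, hB, rfl⟩, rfl⟩
    obtain ⟨F', rfl⟩ := exists_eq_pad hB.1
    exact ⟨F', (isPopularBase_pad_iff hloop hweak).1 hB, hind F'⟩
  · rintro ⟨F', hF', rfl⟩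
    exact ⟨_, ⟨_, (isPopularBase_pad_iff hloop hweak).2 hF', rfl⟩, hind F'⟩

end

end ColorfulGraph

theorem mainTheorem9 {U E : Type*} [Fintype E] {n : ℕ} (H : ColorfulGraph U E n)
    (hloop : H.Loopless) (hweak : H.WeakRankings)
    (F : Finset (E ⊕ Fin n)) (C : EdgeChain (E ⊕ Fin n)) (hret : H.padded.Returns F C) :
    H.padded.IsDualCertificate F C ∧ C.len ≤ 2 ∧
      LinearMap.funLeft ℝ ℝ (Sum.inl : E → E ⊕ Fin n) '' H.padded.chainFace C =
        H.popularForestPolytope := by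
  exact ⟨(hret.isDualCertificate (ColorfulGraph.padded_isPadding hloop hweak)).1,
    (hret.isDualCertificate (ColorfulGraph.padded_isPadding hloop hweak)).2,
    ColorfulGraph.image_chainFace_eq hloop hweak hret⟩
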